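/- Let $\mathrm{sat}_M(y)=\max\{-M,\min\{M,y\}\}$ for $M\in(0,\infty)$ and $\mathrm{sat}_{\infty}(y)=y$. Fix design parameters $K_{VC},K_{CC},\mu_d,\mu_q,\Gamma_d,\Gamma_q,\varepsilon,\omega_{pc},\omega_{qc},\overline Q>0$ (real), $\overline P\in(0,+\infty]$ and $\xi_p,\xi_q>1$, setpoints $\omega_0,V_0,P_0,Q_0\in\mathbb R$, droop coefficients $K_P,K_Q\in\mathbb R$, and physical parameters $\Omega=(\omega_b,C_f,L_f,R_f,L,R)\in\mathbb R_{>0}^6$. For $x=(v_{cd},v_{cq},i_{td},i_{tq},i_{gd},i_{gq},q_1,q_2,p_1,p_2)\in\mathbb R^{10}$ put $$p=v_{cd}i_{gd}+v_{cq}i_{gq},\quad q=v_{cq}i_{gd}-v_{cd}i_{gq},\quad \omega=\omega_0+K_P(P_0-p_1),\quad v^r_{cd}=V_0+K_Q(Q_0-q_1),$$ $$i^r_{td}=i_{gd}-C_f\omega v_{cq}-\tfrac{C_fK_Q}{\omega_b}q_2-\tfrac{C_fK_{VC}}{\omega_b}(v_{cd}-v^r_{cd}),\qquad i^r_{tq}=i_{gq}+C_f\omega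 v_{cd}-\tfrac{C_fK_{VC}}{\omega_b}v_{cq},$$ $$W_d=\tfrac12(v_{cd}-v^r_{cd})^2+\tfrac12(i_{td}-i^r_{td})^2,\qquad W_q=\tfrac12v_{cq}^2+\tfrac12(i_{tq}-i^r_{tq})^2,$$ and, for adaptive gains $z_d,z_q\in\mathbb R$, $$u_d=-\Big(K_{CC}+\tfrac{(1+e^{z_d})\omega_b^2}{4\mu_d}(1+i_{gd}^2+v_{cd}^2)\Big)(i_{td}-i^r_{td})-\tfrac{\omega_b}{C_f}(v_{cd}-v^r_{cd}),$$ $$u_q=-\Big(K_{CC}+\tfrac{(1+e^{z_q})\omega_b^2}{4\mu_q}(1+i_{gq}^2+v_{cq}^2)\Big)(i_{tq}-i^r_{tq})-\tfrac{\omega_b}{C_f}v_{cq},$$ $$\begin{aligned}v_{td}=\tfrac{L_f}{\omega_b}\Big[&-2\omega_b\omega(i_{tq}-i_{gq})+\tfrac{\omega_bR_f}{L_f}i_{td}+\omega_b\big(\tfrac1{L_f}+\omega^2C_f\big)v_{cd}+C_fK_Pp_2v_{cq}-K_{VC}(i_{td}-i^r_{td})\\&+\tfrac{C_fK_{VC}^2}{\omega_b}(v_{cd}-v^r_{cd})+\tfrac{2\xi_q\omega_{qc}K_QC_f}{\omega_b}q_2+\tfrac{\omega_{qc}^2K_QC_f}{\omega_b}\big(q_1-\mathrm{sat}_{\overline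 Q}(q)\big)+u_d\Big],\end{aligned}$$ $$\begin{aligned}v_{tq}=\tfrac{L_f}{\omega_b}\Big[&2\omega_b\omega(i_{td}-i_{gd})+\tfrac{\omega_bR_f}{L_f}i_{tq}+\omega_b\big(\tfrac1{L_f}+C_f\omega^2+\tfrac{C_fK_{VC}^2}{\omega_b^2}\big)v_{cq}\\&-C_fK_Pp_2v_{cd}-K_{VC}(i_{tq}-i^r_{tq})+u_q\Big].\end{aligned}$$ For grid voltages $v_{gd},v_{gq}:[0,\infty)\to\mathbb R$ consider the closed-loop system $$\begin{aligned} \dot v_{cd}&=\omega_b\omega v_{cq}+\tfrac{\omega_b}{C_f}(i_{td}-i_{gd}),&\dot v_{cq}&=-\omega_b\omega v_{cd}+\tfrac{\omega_b}{C_f}(i_{tq}-i_{gq}),\\ \dot i_{td}&=\omega_b\omega i_{tq}+\tfrac{\omega_b}{L_f}(v_{td}-v_{cd})-\tfrac{\omega_bR_f}{L_f}i_{td},&\dot i_{tq}&=-\omega_b\omega i_{td}+\tfrac{\omega_b}{L_f}(v_{tq}-v_{cq})-\tfrac{\omega_bR_f}{L_f}i_{tq},\\ \dot i_{gd}&=\omega_b\omega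 i_{gq}+\tfrac{\omega_b}{L}(v_{cd}-v_{gd})-\tfrac{\omega_bR}{L}i_{gd},&\dot i_{gq}&=-\omega_b\omega i_{gd}+\tfrac{\omega_b}{L}(v_{cq}-v_{gq})-\tfrac{\omega_bR}{L}i_{gq},\\ \dot q_1&=q_2,&\dot q_2&=-2\xi_q\omega_{qc}q_2-\omega_{qc}^2\big(q_1-\mathrm{sat}_{\overline Q}(q)\big),\\ \dot p_1&=p_2,&\dot p_2&=-2\xi_p\omega_{pc}p_2-\omega_{pc}^2\big(p_1-\mathrm{sat}_{\overline P}(p)\big),\\ \dot z_d&=\Gamma_de^{-z_d}\max\{W_d-\varepsilon,0\},&\dot z_q&=\Gamma_qe^{-z_q}\max\{W_q-\varepsilon,0\}. \end{aligned}$$ A solution on an interval $[0,T)$, $T\in(0,+\infty]$, is a function $(x,z_d,z_q)$ that is absolutely continuous on every compact subinterval and satisfies these equations for almost every $t\in[0,T)$. Then there is a continuous function $B:\mathbb R^{10}\times\mathbb R\times\mathbb R\times[0,\infty)\times[0,\infty)\to[0,\infty)$, depending only on the parameters fixed above, such that for all $v_{gd},v_{gq}\in L^\infty([0,\infty);\mathbb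 R)$ and every initial state $(x_0,z_{d,0},z_{q,0})\in\mathbb R^{10}\times\mathbb R\times\mathbb R$ the system has a solution $(x,z_d,z_q)$ on $[0,\infty)$ with this initial state; every solution on an interval $[0,T)$, $T\in(0,+\infty]$, with the same initial state coincides with it on $[0,T)$; and, writing $\bar B=B(x_0,z_{d,0},z_{q,0},\|v_{gd}\|_\infty,\|v_{gq}\|_\infty)$ with essential-supremum norms, $$\|x(t)\|\le\bar B\quad\text{for all }t\ge0\quad\text{(Euclidean norm)},$$ while for $\ell\in\{d,q\}$ the gain $z_\ell$ is non-decreasing on $[0,\infty)$, $\lim_{s\to\infty}z_\ell(s)$ exists and is finite, and $$z_{\ell,0}\le z_\ell(t)\le\lim_{s\to\infty}z_\ell(s)\le\bar B\quad\text{for all }t\ge0.$$ -/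

import Mathlib

open MeasureTheory Filter Topology Set
open scoped NNReal ENNReal

namespace GFM

/-- The saturation function with threshold `M ∈ (0, +∞]`; for `M = ⊤` it is the identity. -/
noncomputable def sat (M : EReal) (y : ℝ) : ℝ :=
  if M < (y : EReal) then M.toReal
  else if (y : EReal) < -M then -M.toReal
  else y

/-- The constant physical parameters `Ω = [ω_b, C_f, L_f, R_f, L, R]`. -/
structure PhysParams where
  ωb : ℝ
  Cf : ℝ
  Lf : ℝ
  Rf : ℝ
  L : ℝ
  R : ℝ

/-- `Ω` lies in the open positive orthant of `ℝ⁶`. -/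
structure PhysParams.Pos (Ω : PhysParams) : Prop where
  ωb : 0 < Ω.ωb
  Cf : 0 < Ω.Cf
  Lf : 0 < Ω.Lf
  Rf : 0 < Ω.Rf
  L : 0 < Ω.L
  R : 0 < Ω.R

/-- Design parameters, setpoints and droop coefficients. The reactive-power saturation
threshold `Qbar` is finite, the active-power threshold `Pbar` may be `⊤`. -/
structure DesignParams where
  KVC : ℝ
  KCC : ℝ
  μd : ℝ
  μq : ℝ
  Γd : ℝ
  Γq : ℝ
  ε : ℝ
  ωpc : ℝ
  ωqc : ℝ
  Qbar : ℝ
  Pbar : EReal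
  ξp : ℝ
  ξq : ℝ
  ω₀ : ℝ
  V₀ : ℝ
  P₀ : ℝ
  Q₀ : ℝ
  KP : ℝ
  KQ : ℝ

/-- The conditions on the design parameters; setpoints and droop coefficients are arbitrary. -/
structure DesignParams.Admissible (D : DesignParams) : Prop where
  KVC : 0 < D.KVC
  KCC : 0 < D.KCC
  μd : 0 < D.μd
  μq : 0 < D.μq
  Γd : 0 < D.Γd
  Γq : 0 < D.Γq
  ε : 0 < D.ε
  ωpc : 0 < D.ωpc
  ωqc : 0 < D.ωqc
  Qbar : 0 < D.Qbar
  Pbar : 0 < D.Pbar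
  ξp : 1 < D.ξp
  ξq : 1 < D.ξq

/-- The space of the state `x = [v_cd, v_cq, i_td, i_tq, i_gd, i_gq, q₁, q₂, p₁, p₂]`, with the
Euclidean norm. -/
abbrev X : Type := EuclideanSpace ℝ (Fin 10)

/-- The space of the closed-loop state `(x, z_d, z_q)`. -/
abbrev State : Type := X × ℝ × ℝ

section Coordinates

variable (x : X)

def vcd : ℝ := x 0

def vcq : ℝ := x 1

def itd : ℝ := x 2

def itq : ℝ := x 3

def igd : ℝ := x 4

def igq : ℝ := x 5

def q₁ : ℝ := x 6

def q₂ : ℝ := x 7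

def p₁ : ℝ := x 8

def p₂ : ℝ := x 9

end Coordinates

section Model

variable (Ω : PhysParams) (D : DesignParams) (x : X)

/-- Instantaneous active power at the PCC. -/
def actPower : ℝ := vcd x * igd x + vcq x * igq x

/-- Instantaneous reactive power at the PCC. -/
def reactPower : ℝ := vcq x * igd x - vcd x * igq x

/-- Droop-generated frequency `ω`. -/
def freq : ℝ := D.ω₀ + D.KP * (D.P₀ - p₁ x)

/-- Droop-generated d-axis voltage reference `v_cd^r` (the q-axis reference is `0`). -/
def vcdRef : ℝ := D.V₀ + D.KQ * (D.Q₀ - q₁ x)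

/-- Right-hand side of the equations of the inverter circuit and of the power filters, for
the terminal voltages `(vtd, vtq)` and the grid voltages `(vgd, vgq)`. -/
noncomputable def plant (vtd vtq vgd vgq : ℝ) : X :=
  WithLp.toLp 2 ![
    Ω.ωb * freq D x * vcq x + Ω.ωb / Ω.Cf * (itd x - igd x),
    -(Ω.ωb * freq D x * vcd x) + Ω.ωb / Ω.Cf * (itq x - igq x),
    Ω.ωb * freq D x * itq x + Ω.ωb / Ω.Lf * (vtd - vcd x) - Ω.ωb * Ω.Rf / Ω.Lf * itd x,
    -(Ω.ωb * freq D x * itd x) + Ω.ωb / Ω.Lf * (vtq - vcq x) - Ω.ωb * Ω.Rf / Ω.Lf * itq x,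
    Ω.ωb * freq D x * igq x + Ω.ωb / Ω.L * (vcd x - vgd) - Ω.ωb * Ω.R / Ω.L * igd x,
    -(Ω.ωb * freq D x * igd x) + Ω.ωb / Ω.L * (vcq x - vgq) - Ω.ωb * Ω.R / Ω.L * igq x,
    q₂ x,
    -(2 * D.ξq * D.ωqc * q₂ x) - D.ωqc ^ 2 * (q₁ x - sat D.Qbar (reactPower x)),
    p₂ x,
    -(2 * D.ξp * D.ωpc * p₂ x) - D.ωpc ^ 2 * (p₁ x - sat D.Pbar (actPower x))]

/-- Reference terminal current `i_td^r`. -/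
noncomputable def itdRef : ℝ :=
  igd x - Ω.Cf * freq D x * vcq x - Ω.Cf * D.KQ / Ω.ωb * q₂ x
    - Ω.Cf * D.KVC / Ω.ωb * (vcd x - vcdRef D x)

/-- Reference terminal current `i_tq^r`. -/
noncomputable def itqRef : ℝ :=
  igq x + Ω.Cf * freq D x * vcd x - Ω.Cf * D.KVC / Ω.ωb * vcq x

/-- Auxiliary d-axis input `u_d`. -/
noncomputable def ud (zd : ℝ) : ℝ :=
  -(D.KCC + (1 + Real.exp zd) * Ω.ωb ^ 2 / (4 * D.μd) * (1 + igd x ^ 2 + vcd x ^ 2))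
      * (itd x - itdRef Ω D x)
    - Ω.ωb / Ω.Cf * (vcd x - vcdRef D x)

/-- Auxiliary q-axis input `u_q`. -/
noncomputable def uq (zq : ℝ) : ℝ :=
  -(D.KCC + (1 + Real.exp zq) * Ω.ωb ^ 2 / (4 * D.μq) * (1 + igq x ^ 2 + vcq x ^ 2))
      * (itq x - itqRef Ω D x)
    - Ω.ωb / Ω.Cf * vcq x

/-- The d-axis control law for the terminal voltage `v_td`. -/
noncomputable def vtd (zd : ℝ) : ℝ :=
  Ω.Lf / Ω.ωb * (
    -(2 * Ω.ωb * freq D x * (itq x - igq x)) + Ω.ωb * Ω.Rf / Ω.Lf * itd x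
    + Ω.ωb * (1 / Ω.Lf + freq D x ^ 2 * Ω.Cf) * vcd x + Ω.Cf * D.KP * p₂ x * vcq x
    - D.KVC * (itd x - itdRef Ω D x) + Ω.Cf * D.KVC ^ 2 / Ω.ωb * (vcd x - vcdRef D x)
    + 2 * D.ξq * D.ωqc * D.KQ * Ω.Cf / Ω.ωb * q₂ x
    + D.ωqc ^ 2 * D.KQ * Ω.Cf / Ω.ωb * (q₁ x - sat D.Qbar (reactPower x))
    + ud Ω D x zd)

/-- The q-axis control law for the terminal voltage `v_tq`. -/
noncomputable def vtq (zq : ℝ) : ℝ :=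
  Ω.Lf / Ω.ωb * (
    2 * Ω.ωb * freq D x * (itd x - igd x) + Ω.ωb * Ω.Rf / Ω.Lf * itq x
    + Ω.ωb * (1 / Ω.Lf + Ω.Cf * freq D x ^ 2 + Ω.Cf * D.KVC ^ 2 / Ω.ωb ^ 2) * vcq x
    - Ω.Cf * D.KP * p₂ x * vcd x
    - D.KVC * (itq x - itqRef Ω D x) + uq Ω D x zq)

/-- The energy signal `W_d`. -/
noncomputable def Wd : ℝ :=
  1 / 2 * (vcd x - vcdRef D x) ^ 2 + 1 / 2 * (itd x - itdRef Ω D x) ^ 2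

/-- The energy signal `W_q`. -/
noncomputable def Wq : ℝ :=
  1 / 2 * vcq x ^ 2 + 1 / 2 * (itq x - itqRef Ω D x) ^ 2

end Model

/-- Right-hand side of the closed loop in the state `s = (x, z_d, z_q)`, for the grid voltages
`(vgd, vgq)`. -/
noncomputable def closedLoop (Ω : PhysParams) (D : DesignParams) (vgd vgq : ℝ) (s : State) :
    State :=
  (plant Ω D s.1 (vtd Ω D s.1 s.2.1) (vtq Ω D s.1 s.2.2) vgd vgq,
    D.Γd * Real.exp (-s.2.1) * max (Wd Ω D s.1 - D.ε) 0,
    D.Γq * Real.exp (-s.2.2) * max (Wq Ω D s.1 - D.ε) 0)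

/-- `s` is an absolutely continuous solution, on an interval `I` of times containing `0`, of the
closed loop with grid voltages `vgd, vgq` and initial state `s₀`: it is absolutely continuous on
every compact subinterval of `I` and satisfies the differential equations almost everywhere
on `I`. Only the values of `s` on `I` matter. -/
structure IsSolutionOn (Ω : PhysParams) (D : DesignParams) (vgd vgq : ℝ → ℝ) (s₀ : State)
    (I : Set ℝ) (s : ℝ → State) : Prop where
  init : s 0 = s₀
  absCont : ∀ a ∈ I, ∀ b ∈ I, AbsolutelyContinuousOnInterval s a b
  ode : ∀ᵐ t ∂(volume.restrict I), HasDerivAt s (closedLoop Ω D (vgd t) (vgq t) (s t)) t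

/-- Lebesgue measure on the half-line `[0, ∞)`. -/
noncomputable def halfLine : Measure ℝ := volume.restrict (Ici 0)

/-- The essential supremum norm of a function on `[0, ∞)`. -/
noncomputable def supNorm (v : ℝ → ℝ) : ℝ≥0 := (eLpNorm v ⊤ halfLine).toNNReal

end GFM

/-! The control law is a backstepping design. In the tracking errors of voltage and terminal current
it cancels everything except the unmeasured forcing `ωb / L * (v_g - v_c + R * i_g)`, which comes
from differentiating the grid current. The gain multiplying the current error contains `(1 + exp z)
* (1 + i_g ^ 2 + v_c ^ 2)`, so Cauchy–Schwarz and Young absorb this forcing (`dissipation_le`),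
leaving `W' ≤ -κ W + b / (1 + exp z)` with `b` depending only on the parameters and the size of the
grid voltage.

Hence `W` is bounded whatever `z` does. The gain is bounded as well (`adaptive_gain_bounds`): once
`exp z` passes the level where the forcing is at most `κ ε`, the excess of `W` over the dead zone
decays exponentially, and since `(exp z)' = Γ * max (W - ε) 0`, only a finite further increase is
possible.

The remaining states follow as a cascade (`isUniformlyBounded_coord`). The finite threshold `Qbar`
bounds the reactive-power filter unconditionally, hence the voltage reference and the voltages; the
resistive grid line then bounds the grid currents; so the active power is bounded, and with it its
filter, the frequency and the terminal currents.

These a priori bounds exclude blow-up. The vector field is locally Lipschitz and the grid voltages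
enter additively, so subtracting their primitive reduces existence to Picard–Lindelöf, while
Grönwall gives uniqueness. The bounds are uniform for bounded data, hence locally constant choices
exist, and a partition of unity makes the final bound continuous. -/

/-! ### Absolutely continuous functions and differential inequalities -/

section AbsolutelyContinuous

variable {X Y : Type*} [PseudoMetricSpace X] [PseudoMetricSpace Y]

/-- A Lipschitz function of an absolutely continuous function is absolutely continuous. -/
theorem LipschitzOnWith.comp_absolutelyContinuousOnInterval {f : ℝ → X} {g : X → Y} {K : ℝ≥0}
    {a b : ℝ} (hg : LipschitzOnWith K g (f '' uIcc a b))
    (hf : AbsolutelyContinuousOnInterval f a b) :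
    AbsolutelyContinuousOnInterval (fun t => g (f t)) a b := by
  rw [absolutelyContinuousOnInterval_iff] at hf ⊢
  intro ε hε
  obtain ⟨δ, hδ, h⟩ := hf (ε / (K + 1)) (by positivity)
  refine ⟨δ, hδ, fun P hP hPδ => ?_⟩
  calc _ ≤ ∑ i ∈ Finset.range P.1, K * dist (f (P.2 i).1) (f (P.2 i).2) :=
        Finset.sum_le_sum fun i hi => hg.dist_le_mul _ (mem_image_of_mem _ (hP.1 i hi).1) _
          (mem_image_of_mem _ (hP.1 i hi).2)
    _ = K * ∑ i ∈ Finset.range P.1, dist (f (P.2 i).1) (f (P.2 i).2) :=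
        (Finset.mul_sum _ _ _).symm
    _ ≤ K * (ε / (K + 1)) := by gcongr; exact (h P hP hPδ).le
    _ < (K + 1) * (ε / (K + 1)) := by gcongr; linarith
    _ = ε := by field

theorem LocallyLipschitz.comp_absolutelyContinuousOnInterval {E : Type*}
    [NormedAddCommGroup E] {f : ℝ → E} {g : E → Y} {a b : ℝ} (hg : LocallyLipschitz g)
    (hf : AbsolutelyContinuousOnInterval f a b) :
    AbsolutelyContinuousOnInterval (fun t => g (f t)) a b := by
  have hc : IsCompact (f '' uIcc a b) := isCompact_uIcc.image_of_continuousOn hf.continuousOn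
  have hl : LocallyLipschitzOn (f '' uIcc a b) g := hg.locallyLipschitzOn
  obtain ⟨K, hK⟩ := hl.exists_lipschitzOnWith_of_compact hc
  exact hK.comp_absolutelyContinuousOnInterval hf

theorem ContDiff.comp_absolutelyContinuousOnInterval {E F : Type*} [NormedAddCommGroup E]
    [NormedSpace ℝ E] [NormedAddCommGroup F] [NormedSpace ℝ F] {f : ℝ → E} {g : E → F} {a b : ℝ}
    (hg : ContDiff ℝ 1 g) (hf : AbsolutelyContinuousOnInterval f a b) :
    AbsolutelyContinuousOnInterval (fun t => g (f t)) a b :=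
  hg.locallyLipschitz.comp_absolutelyContinuousOnInterval hf

theorem AbsolutelyContinuousOnInterval.congr {f g : ℝ → X} {a b : ℝ}
    (hf : AbsolutelyContinuousOnInterval f a b) (h : EqOn f g (uIcc a b)) :
    AbsolutelyContinuousOnInterval g a b := by
  rw [absolutelyContinuousOnInterval_iff] at hf ⊢
  intro ε hε
  obtain ⟨δ, hδ, h'⟩ := hf ε hε
  refine ⟨δ, hδ, fun P hP hPδ => ?_⟩
  rw [Finset.sum_congr rfl fun i hi => by rw [← h (hP.1 i hi).1, ← h (hP.1 i hi).2]]
  exact h' P hP hPδ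

/-- A real absolutely continuous function with almost everywhere nonpositive derivative
does not increase. -/
theorem AbsolutelyContinuousOnInterval.le_of_ae_deriv_nonpos {f : ℝ → ℝ} {a b : ℝ} (hab : a ≤ b)
    (hf : AbsolutelyContinuousOnInterval f a b)
    (h : ∀ᵐ t ∂volume.restrict (Icc a b), ∃ f', HasDerivAt f f' t ∧ f' ≤ 0) : f b ≤ f a := by
  rw [← sub_nonpos, ← hf.integral_deriv_eq_sub, intervalIntegral.integral_of_le hab]
  apply integral_nonpos_of_ae
  filter_upwards [ae_restrict_of_ae_restrict_of_subset Ioc_subset_Icc_self h]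
  rintro t ⟨f', hf', hle⟩
  simpa [hf'.deriv] using hle

theorem monotoneOn_of_ae_deriv_nonneg {z : ℝ → ℝ} {I : Set ℝ} (hI : I.OrdConnected)
    (hz : ∀ a ∈ I, ∀ b ∈ I, AbsolutelyContinuousOnInterval z a b)
    (h : ∀ᵐ t ∂volume.restrict I, ∃ z', HasDerivAt z z' t ∧ 0 ≤ z') : MonotoneOn z I := by
  intro a ha b hb hab
  have := (hz a ha b hb).fun_neg.le_of_ae_deriv_nonpos hab (by
    filter_upwards [ae_restrict_of_ae_restrict_of_subset (hI.out ha hb) h]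
    rintro t ⟨z', hz', hle⟩
    exact ⟨_, hz'.fun_neg, neg_nonpos.2 hle⟩)
  linarith

theorem ae_restrict_Icc_mono {p : ℝ → Prop} {a b c d : ℝ}
    (h : ∀ᵐ t ∂volume.restrict (Icc a b), p t) (hac : a ≤ c) (hdb : d ≤ b) :
    ∀ᵐ t ∂volume.restrict (Icc c d), p t :=
  ae_restrict_of_ae_restrict_of_subset (Icc_subset_Icc hac hdb) h

/-- Comparison with the linear equation `f' = -a f + b`. -/
theorem AbsolutelyContinuousOnInterval.sub_le_exp_of_ae_deriv_le {f : ℝ → ℝ} {t₀ t₁ a b : ℝ}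
    (ht : t₀ ≤ t₁) (ha : 0 < a) (hf : AbsolutelyContinuousOnInterval f t₀ t₁)
    (h : ∀ᵐ t ∂volume.restrict (Icc t₀ t₁), ∃ f', HasDerivAt f f' t ∧ f' ≤ -a * f t + b) :
    f t₁ - b / a ≤ (f t₀ - b / a) * Real.exp (-a * (t₁ - t₀)) := by
  -- Integrating factor: `exp (a * (t - t₀)) * (f t - b / a)` has nonpositive derivative almost
  -- everywhere.
  have hac : AbsolutelyContinuousOnInterval
      (fun t => Real.exp (a * (t - t₀)) * (f t - b / a)) t₀ t₁ := by
    refine AbsolutelyContinuousOnInterval.fun_mul (f := fun t => Real.exp (a * (t - t₀)))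
      (g := fun t => f t - b / a) ?_ ?_
    · exact ContDiffOn.absolutelyContinuousOnInterval (by fun_prop)
    · exact (show ContDiff ℝ 1 fun y : ℝ => y - b / a by
        fun_prop).comp_absolutelyContinuousOnInterval hf
  have key := hac.le_of_ae_deriv_nonpos ht (by
    filter_upwards [h]
    rintro t ⟨f', hf', hle⟩
    refine ⟨_, (((((hasDerivAt_id t).sub_const t₀).const_mul a).exp).mul (hf'.sub_const (b / a))),
      ?_⟩
    have he := Real.exp_pos (a * (t - t₀))
    have : a * (f t - b / a) + f' ≤ 0 := by
      have : a * (f t - b / a) = a * f t - b := by field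
      linarith
    simp only [id_eq]
    nlinarith)
  simp only [sub_self, mul_zero, Real.exp_zero, one_mul] at key
  have he := Real.exp_pos (-a * (t₁ - t₀))
  calc f t₁ - b / a
      = Real.exp (a * (t₁ - t₀)) * (f t₁ - b / a) * Real.exp (-a * (t₁ - t₀)) := by
        rw [mul_right_comm, ← Real.exp_add]; simp
    _ ≤ _ := by gcongr

/-- The exponential comparison bounds `f t₁` by a convex combination of the initial value and the
equilibrium `b / a`. -/
theorem AbsolutelyContinuousOnInterval.le_max_of_ae_deriv_le {f : ℝ → ℝ} {t₀ t₁ a b : ℝ}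
    (ht : t₀ ≤ t₁) (ha : 0 < a) (hf : AbsolutelyContinuousOnInterval f t₀ t₁)
    (h : ∀ᵐ t ∂volume.restrict (Icc t₀ t₁), ∃ f', HasDerivAt f f' t ∧ f' ≤ -a * f t + b) :
    f t₁ ≤ max (f t₀) (b / a) := by
  have key := hf.sub_le_exp_of_ae_deriv_le ht ha h
  have he : Real.exp (-a * (t₁ - t₀)) ≤ 1 := by
    rw [Real.exp_le_one_iff]; nlinarith
  have he' := Real.exp_pos (-a * (t₁ - t₀))
  rcases le_total (f t₀) (b / a) with h0 | h0
  · exact le_max_of_le_right (by nlinarith)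
  · exact le_max_of_le_left (by nlinarith)

/-- A scalar stable linear equation with input bounded by `β` has bounded solutions. -/
theorem AbsolutelyContinuousOnInterval.abs_le_max_of_ae_deriv_eq {f g : ℝ → ℝ} {t₀ t₁ a β : ℝ}
    (ht : t₀ ≤ t₁) (ha : 0 < a) (hf : AbsolutelyContinuousOnInterval f t₀ t₁)
    (hg : ∀ t ∈ Icc t₀ t₁, |g t| ≤ β)
    (h : ∀ᵐ t ∂volume.restrict (Icc t₀ t₁), HasDerivAt f (-a * f t + g t) t) :
    |f t₁| ≤ max |f t₀| (β / a) := by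
  rw [abs_le']
  have hmem := ae_restrict_mem (μ := volume) (measurableSet_Icc (a := t₀) (b := t₁))
  constructor
  · refine (hf.le_max_of_ae_deriv_le ht ha (b := β) ?_).trans (max_le_max (le_abs_self _) le_rfl)
    filter_upwards [h, hmem] with t h1 h2
    exact ⟨_, h1, by linarith [le_abs_self (g t), hg t h2]⟩
  · refine (hf.fun_neg.le_max_of_ae_deriv_le ht ha (b := β) ?_).trans
      (max_le_max (neg_le_abs _) le_rfl)
    filter_upwards [h, hmem] with t h1 h2
    exact ⟨_, h1.neg, by linarith [neg_le_abs (g t), hg t h2]⟩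

end AbsolutelyContinuous

/-! ### Carathéodory solutions of `s' = F(s) + u(t)`: uniqueness and global existence -/

section Caratheodory

variable {E : Type*} [NormedAddCommGroup E] [NormedSpace ℝ E]

/-- `s` is an absolutely continuous solution of `s' = F(s) + u(t)` on the set of times `I`. -/
structure IsCaratheodorySolutionOn (F : E → E) (u : ℝ → E) (I : Set ℝ) (s : ℝ → E) : Prop where
  absCont : ∀ a ∈ I, ∀ b ∈ I, AbsolutelyContinuousOnInterval s a b
  ode : ∀ᵐ t ∂(volume.restrict I), HasDerivAt s (F (s t) + u t) t

/-- `U` is a primitive of `u` on the half-line, in the sense of absolutely continuous functions. -/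
structure IsPrimitiveOnHalfLine (U u : ℝ → E) : Prop where
  zero : U 0 = 0
  absCont : ∀ a b, AbsolutelyContinuousOnInterval U a b
  hasDerivAt : ∀ᵐ t ∂(volume.restrict (Ici 0)), HasDerivAt U (u t) t

namespace IsCaratheodorySolutionOn

variable {F : E → E} {u s s₁ s₂ : ℝ → E} {I J : Set ℝ} {T : ℝ}

theorem mono (h : IsCaratheodorySolutionOn F u I s) (hJ : J ⊆ I) :
    IsCaratheodorySolutionOn F u J s :=
  ⟨fun a ha b hb => h.absCont a (hJ ha) b (hJ hb), ae_restrict_of_ae_restrict_of_subset hJ h.ode⟩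

/-- The input `u` cancels in the difference of two solutions, which therefore equals the integral of
the continuous function `F (s₁ t) - F (s₂ t)`. That integral is differentiable everywhere, so the
classical Grönwall inequality applies to it although the solutions are differentiable only almost
everywhere. -/
theorem eqOn_Icc [CompleteSpace E] (hF : LocallyLipschitz F) (hT : 0 ≤ T)
    (h₁ : IsCaratheodorySolutionOn F u (Icc 0 T) s₁)
    (h₂ : IsCaratheodorySolutionOn F u (Icc 0 T) s₂) (h₀ : s₁ 0 = s₂ 0) :
    EqOn s₁ s₂ (Icc 0 T) := by
  have hu : uIcc 0 T = Icc 0 T := uIcc_of_le hT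
  have ac₁ := h₁.absCont 0 (left_mem_Icc.2 hT) T (right_mem_Icc.2 hT)
  have ac₂ := h₂.absCont 0 (left_mem_Icc.2 hT) T (right_mem_Icc.2 hT)
  have c₁ : ContinuousOn s₁ (Icc 0 T) := hu ▸ ac₁.continuousOn
  have c₂ : ContinuousOn s₂ (Icc 0 T) := hu ▸ ac₂.continuousOn
  have hφ : ContinuousOn (fun t => F (s₁ t) - F (s₂ t)) (Icc 0 T) :=
    (hF.continuous.comp_continuousOn c₁).sub (hF.continuous.comp_continuousOn c₂)
  -- Constant extension beyond the endpoints makes `φ` continuous on the whole line and its integral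
  -- `D` of class C¹.
  set φ : ℝ → E := IccExtend hT ((Icc 0 T).domRestrict fun t => F (s₁ t) - F (s₂ t)) with hφdef
  have φc : Continuous φ := by
    rw [hφdef]; exact (continuousOn_iff_continuous_domRestrict.1 hφ).Icc_extend'
  have φeq : ∀ t ∈ Icc 0 T, φ t = F (s₁ t) - F (s₂ t) := fun t ht => by
    rw [hφdef, IccExtend_of_mem hT _ ht]; rfl
  have hD : ∀ t, HasDerivAt (fun t => ∫ τ in (0 : ℝ)..t, φ τ) (φ t) t := fun t =>
    intervalIntegral.integral_hasDerivAt_right (φc.intervalIntegrable _ _)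
      (φc.stronglyMeasurableAtFilter _ _) φc.continuousAt
  set D : ℝ → E := fun t => ∫ τ in (0 : ℝ)..t, φ τ with hDdef
  have hDC : ContDiff ℝ 1 D := contDiff_one_iff_deriv.2
    ⟨fun t => (hD t).differentiableAt, by
      rw [show deriv D = φ from funext fun t => (hD t).deriv]; exact φc⟩
  obtain ⟨C, hC⟩ := ((ac₁.fun_sub ac₂).fun_sub
    hDC.contDiffOn.absolutelyContinuousOnInterval).const_of_ae_hasDerivAt_zero (by
      rw [hu, ← ae_restrict_iff' measurableSet_Icc]
      filter_upwards [h₁.ode, h₂.ode, ae_restrict_mem measurableSet_Icc] with t d₁ d₂ ht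
      exact ((d₁.fun_sub d₂).fun_sub (hD t)).congr_deriv (by rw [φeq t ht]; abel))
  rw [hu] at hC
  have hC0 : C = 0 := by
    rw [← hC 0 (left_mem_Icc.2 hT)]; simp [hDdef, h₀]
  have hdD : ∀ t ∈ Icc 0 T, s₁ t - s₂ t = D t := fun t ht => by
    have := hC t ht
    rwa [hC0, sub_eq_zero] at this
  have hcomp : IsCompact (s₁ '' Icc 0 T ∪ s₂ '' Icc 0 T) :=
    (isCompact_Icc.image_of_continuousOn c₁).union (isCompact_Icc.image_of_continuousOn c₂)
  have hl : LocallyLipschitzOn (s₁ '' Icc 0 T ∪ s₂ '' Icc 0 T) F := hF.locallyLipschitzOn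
  obtain ⟨K, hK⟩ := hl.exists_lipschitzOnWith_of_compact hcomp
  intro t ht
  have := norm_le_gronwallBound_of_norm_deriv_right_le (f := D) (f' := φ) (δ := 0) (K := K)
    (ε := 0) (a := 0) (b := T) hDC.continuous.continuousOn
    (fun t _ => (hD t).hasDerivWithinAt) (by simp [hDdef]) (fun t ht => by
      have ht' := Ico_subset_Icc_self ht
      rw [φeq t ht', ← hdD t ht', add_zero]
      exact hK.norm_sub_le (Or.inl (mem_image_of_mem _ ht')) (Or.inr (mem_image_of_mem _ ht')))
    t ht
  rw [gronwallBound_ε0_δ0, ← hdD t ht] at this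
  exact sub_eq_zero.1 (norm_le_zero_iff.1 this)

end IsCaratheodorySolutionOn

variable [FiniteDimensional ℝ E] {F : E → E} {U u : ℝ → E} {s₀ : E}

/-- The substitution `s = y + U` gives `y' = F (y + U t)`, whose right-hand side is continuous in
time, so Picard–Lindelöf applies. Boundedness of `F` lets it reach any horizon `T` in one step. -/
theorem exists_isCaratheodorySolutionOn_Icc_of_bounded (hF : LocallyLipschitz F) {L : ℝ≥0}
    (hL : ∀ x, ‖F x‖ ≤ L) (hU : IsPrimitiveOnHalfLine U u) (s₀ : E) {T : ℝ} (hT : 0 ≤ T) :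
    ∃ s, s 0 = s₀ ∧ IsCaratheodorySolutionOn F u (Icc 0 T) s := by
  have : CompleteSpace E := FiniteDimensional.complete ℝ E
  have : ProperSpace E := FiniteDimensional.proper ℝ E
  have hu : uIcc 0 T = Icc 0 T := uIcc_of_le hT
  have Uc : ContinuousOn U (Icc 0 T) := hu ▸ (hU.absCont 0 T).continuousOn
  obtain ⟨b, hb⟩ := isCompact_Icc.exists_bound_of_continuousOn Uc
  -- `y` moves at most `a = L * T` from `s₀` and `U` contributes at most `b`, so a Lipschitz
  -- constant on the ball of radius `a + b` suffices.
  let a : ℝ≥0 := L * ⟨T, hT⟩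
  have hl : LocallyLipschitzOn (Metric.closedBall s₀ (a + b)) F := hF.locallyLipschitzOn
  obtain ⟨K, hK⟩ := hl.exists_lipschitzOnWith_of_compact (isCompact_closedBall _ _)
  have hPL : IsPicardLindelof (fun t y => F (y + U t)) (tmin := 0) (tmax := T)
      ⟨0, left_mem_Icc.2 hT⟩ s₀ a 0 L K := by
    refine ⟨fun t ht => ?_, fun x _ => ?_, fun t _ x _ => hL _, ?_⟩
    · have hlip : LipschitzOnWith 1 (fun y => y + U t) (Metric.closedBall s₀ a) :=
        LipschitzOnWith.of_dist_le_mul fun x _ y _ => by simp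
      have := hK.comp hlip (fun y hy => by
        rw [Metric.mem_closedBall, dist_eq_norm] at hy ⊢
        calc ‖y + U t - s₀‖ = ‖(y - s₀) + U t‖ := by congr 1; abel
          _ ≤ a + b := (norm_add_le _ _).trans (add_le_add hy (hb t ht)))
      rwa [mul_one] at this
    · exact hF.continuous.comp_continuousOn (continuousOn_const.add Uc)
    · simp only [sub_zero, sub_self, max_eq_left hT, NNReal.coe_zero]
      rfl
  obtain ⟨y, hy0, hy⟩ := hPL.exists_eq_forall_mem_Icc_hasDerivWithinAt₀
  refine ⟨fun t => y t + U t, by simpa [hU.zero] using hy0, fun c hc d hd => ?_, ?_⟩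
  · have hlip : LipschitzOnWith L y (Icc 0 T) :=
      (convex_Icc 0 T).lipschitzOnWith_of_nnnorm_hasDerivWithin_le hy fun t _ => hL _
    exact (hlip.mono (uIcc_subset_Icc hc hd)).absolutelyContinuousOnInterval.fun_add
      (hU.absCont c d)
  · have h0 : ∀ c, ∀ᵐ t ∂volume.restrict (Icc 0 T), t ≠ c := fun c =>
      ae_restrict_of_ae (by simp [ae_iff])
    filter_upwards [h0 0, h0 T, ae_restrict_mem measurableSet_Icc,
      ae_restrict_of_ae_restrict_of_subset Icc_subset_Ici_self hU.hasDerivAt] with t h1 h1' h2 h3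
    exact ((hy t h2).hasDerivAt
      (Icc_mem_nhds (h2.1.lt_of_ne' h1) (h2.2.lt_of_ne h1'))).add h3

/-- A compactly supported Lipschitz modification of a locally Lipschitz vector field. -/
theorem LocallyLipschitz.exists_bounded_eqOn_closedBall (hF : LocallyLipschitz F) (R : ℝ) :
    ∃ G : E → E, LocallyLipschitz G ∧ (∃ L : ℝ≥0, ∀ x, ‖G x‖ ≤ L) ∧
      EqOn G F (Metric.closedBall 0 R) := by
  have : ProperSpace E := FiniteDimensional.proper ℝ E
  -- The absolute value keeps the bump radii positive for every real `R`.
  let χ : ContDiffBump (0 : E) := ⟨|R| + 1, |R| + 2, by positivity, by linarith⟩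
  obtain ⟨b, hb⟩ := (isCompact_closedBall (0 : E) (|R| + 2)).exists_bound_of_continuousOn
    hF.continuous.continuousOn
  refine ⟨fun x => χ x • F x, ?_, ⟨b.toNNReal, fun x => ?_⟩, fun x hx => ?_⟩
  · have h1 : LocallyLipschitz fun x => (χ x, F x) :=
      (χ.contDiff (n := 1)).locallyLipschitz.prodMk hF
    have h2 : LocallyLipschitz fun p : ℝ × E => p.1 • p.2 :=
      (contDiff_fst.smul contDiff_snd : ContDiff ℝ 1 fun p : ℝ × E => p.1 • p.2).locallyLipschitz
    exact h2.comp h1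
  · rcases le_total (dist x 0) (|R| + 2) with h | h
    · rw [norm_smul, Real.norm_eq_abs, abs_of_nonneg χ.nonneg]
      refine le_trans ?_ (Real.le_coe_toNNReal b)
      exact (mul_le_of_le_one_left (norm_nonneg _) χ.le_one).trans (hb x h)
    · simp [χ.zero_of_le_dist h]
  · have : χ x = 1 := χ.one_of_mem_closedBall (Metric.closedBall_subset_closedBall
      (show R ≤ |R| + 1 by linarith [le_abs_self R]) hx)
    simp [this]

/-- Truncate `F` outside the ball of radius `C + 1`. Up to the first time its norm reaches `C + 1`,
the truncated solution solves the original equation, so its norm at that time is at most `C`: the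
exit never happens. -/
theorem exists_isCaratheodorySolutionOn_Icc (hF : LocallyLipschitz F)
    (hU : IsPrimitiveOnHalfLine U u) {C : ℝ}
    (hC : ∀ T, 0 ≤ T → ∀ s, s 0 = s₀ → IsCaratheodorySolutionOn F u (Icc 0 T) s → ‖s T‖ ≤ C)
    {T : ℝ} (hT : 0 ≤ T) :
    ∃ s, s 0 = s₀ ∧ IsCaratheodorySolutionOn F u (Icc 0 T) s := by
  obtain ⟨G, hG, ⟨L, hL⟩, hGF⟩ := hF.exists_bounded_eqOn_closedBall (C + 1)
  obtain ⟨s, hs0, hs⟩ := exists_isCaratheodorySolutionOn_Icc_of_bounded hG hL hU s₀ hT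
  have hu : uIcc 0 T = Icc 0 T := uIcc_of_le hT
  have sc : ContinuousOn s (Icc 0 T) :=
    hu ▸ (hs.absCont 0 (left_mem_Icc.2 hT) T (right_mem_Icc.2 hT)).continuousOn
  have key : ∀ τ ∈ Icc 0 T, (∀ t ∈ Ico 0 τ, ‖s t‖ < C + 1) →
      IsCaratheodorySolutionOn F u (Icc 0 τ) s := fun τ hτ hlt => by
    have h := hs.mono (Icc_subset_Icc le_rfl hτ.2)
    refine ⟨h.absCont, ?_⟩
    have h0 : ∀ᵐ t ∂volume.restrict (Icc 0 τ), t ≠ τ :=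
      ae_restrict_of_ae (by simp [ae_iff])
    filter_upwards [h.ode, h0, ae_restrict_mem measurableSet_Icc] with t h1 h2 h3
    rwa [hGF (by simpa using (hlt t ⟨h3.1, h3.2.lt_of_ne h2⟩).le)] at h1
  by_cases hB : ∃ t ∈ Icc 0 T, C + 1 ≤ ‖s t‖
  · have hcl : IsCompact (Icc 0 T ∩ (fun t => ‖s t‖) ⁻¹' Ici (C + 1)) :=
      isCompact_Icc.of_isClosed_subset
        (sc.norm.preimage_isClosed_of_isClosed isClosed_Icc isClosed_Ici) inter_subset_left
    obtain ⟨τ, ⟨hτ, hτC⟩, hmin⟩ := hcl.exists_isLeast hB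
    have := hC τ hτ.1 s hs0 (key τ hτ fun t ht => by
      by_contra! hge
      exact absurd (hmin ⟨⟨ht.1, ht.2.le.trans hτ.2⟩, hge⟩) (not_le.2 ht.2))
    simp only [mem_preimage, mem_Ici] at hτC
    linarith
  · push Not at hB
    exact ⟨s, hs0, key T (right_mem_Icc.2 hT) fun t ht => hB t (Ico_subset_Icc_self ht)⟩

/-- If the solutions of `s' = F(s) + u(t)` from `s₀` obey a common bound, there is one for all
positive times. -/
theorem exists_isCaratheodorySolutionOn_Ici (hF : LocallyLipschitz F)
    (hU : IsPrimitiveOnHalfLine U u) {C : ℝ}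
    (hC : ∀ T, 0 ≤ T → ∀ s, s 0 = s₀ → IsCaratheodorySolutionOn F u (Icc 0 T) s → ‖s T‖ ≤ C) :
    ∃ s, s 0 = s₀ ∧ IsCaratheodorySolutionOn F u (Ici 0) s := by
  have : CompleteSpace E := FiniteDimensional.complete ℝ E
  choose S hS0 hS using fun n : ℕ =>
    exists_isCaratheodorySolutionOn_Icc hF hU hC (T := n) n.cast_nonneg
  -- The horizon `⌊t⌋₊ + 1` exceeds `t`; by uniqueness any other integer horizon at least `t` gives
  -- the same value.
  let s : ℝ → E := fun t => S (⌊t⌋₊ + 1) t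
  have hs : ∀ n : ℕ, EqOn (S n) s (Icc 0 n) := fun n t ht => by
    have hle : t ≤ ((⌊t⌋₊ + 1 : ℕ) : ℝ) := by push_cast; exact (Nat.lt_floor_add_one t).le
    exact ((hS n).mono (Icc_subset_Icc le_rfl ht.2)).eqOn_Icc hF ht.1
      ((hS (⌊t⌋₊ + 1)).mono (Icc_subset_Icc le_rfl hle)) (by rw [hS0, hS0]) (right_mem_Icc.2 ht.1)
  refine ⟨s, by simp [s, hS0], fun a ha b hb => ?_, ?_⟩
  · obtain ⟨n, hn⟩ := exists_nat_ge (max a b)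
    have ha' : a ∈ Icc 0 (n : ℝ) := ⟨ha, (le_max_left _ _).trans hn⟩
    have hb' : b ∈ Icc 0 (n : ℝ) := ⟨hb, (le_max_right _ _).trans hn⟩
    exact ((hS n).absCont a ha' b hb').congr ((hs n).mono (uIcc_subset_Icc ha' hb'))
  · have hall : ∀ᵐ t : ℝ, ∀ n : ℕ, t ∈ Icc 0 (n : ℝ) →
        HasDerivAt (S n) (F (S n t) + u t) t :=
      ae_all_iff.2 fun n => (ae_restrict_iff' measurableSet_Icc).1 (hS n).ode
    have h0 : ∀ᵐ t : ℝ, t ≠ 0 := by simp [ae_iff]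
    rw [ae_restrict_iff' measurableSet_Ici]
    filter_upwards [hall, h0] with t h1 h2 h3
    obtain ⟨n, hn⟩ := exists_nat_gt t
    have hd := h1 n ⟨h3, hn.le⟩
    rw [hs n ⟨h3, hn.le⟩] at hd
    refine hd.congr_of_eventuallyEq ?_
    filter_upwards [Icc_mem_nhds (lt_of_le_of_ne h3 h2.symm) hn] with τ hτ
    exact (hs n hτ).symm

end Caratheodory

/-! ### Local Lipschitz calculus for real functions -/

section LocallyLipschitzReal

variable {α : Type*} [PseudoMetricSpace α] {f g : α → ℝ}

theorem LocallyLipschitz.mul_real (hf : LocallyLipschitz f) (hg : LocallyLipschitz g) :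
    LocallyLipschitz fun x => f x * g x := by
  have h : LocallyLipschitz fun p : ℝ × ℝ => p.1 * p.2 :=
    (contDiff_fst.mul contDiff_snd : ContDiff ℝ 1 fun p : ℝ × ℝ => p.1 * p.2).locallyLipschitz
  exact h.comp (hf.prodMk hg)

theorem LocallyLipschitz.add_real (hf : LocallyLipschitz f) (hg : LocallyLipschitz g) :
    LocallyLipschitz fun x => f x + g x := hf.add hg

theorem LocallyLipschitz.sub_real (hf : LocallyLipschitz f) (hg : LocallyLipschitz g) :
    LocallyLipschitz fun x => f x - g x := hf.sub hg

theorem LocallyLipschitz.pi {ι : Type*} [Fintype ι] {β : Type*} [PseudoMetricSpace β]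
    {f : α → ι → β} (hf : ∀ i, LocallyLipschitz fun x => f x i) : LocallyLipschitz f := by
  intro x
  choose K t ht hK using fun i => hf i x
  refine ⟨Finset.univ.sup K, ⋂ i, t i, Filter.iInter_mem.2 ht, fun y hy z hz => ?_⟩
  rw [edist_pi_le_iff]
  intro i
  refine (hK i (mem_iInter.1 hy i) (mem_iInter.1 hz i)).trans ?_
  gcongr
  exact Finset.le_sup (Finset.mem_univ i)

end LocallyLipschitzReal

/-! ### Saturation, regularity of the closed loop, and the additive grid input -/

namespace GFM

theorem sat_top (y : ℝ) : sat ⊤ y = y := by simp [sat]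

theorem sat_coe {M : ℝ} (hM : 0 < M) (y : ℝ) : sat M y = max (-M) (min M y) := by
  have h : (-(M : EReal)) = ((-M : ℝ) : EReal) := by simp
  simp only [sat, h, EReal.coe_lt_coe_iff, EReal.toReal_coe]
  split_ifs with h1 h2
  · rw [min_eq_left h1.le, max_eq_right (by linarith)]
  · rw [min_eq_right (by linarith), max_eq_left h2.le]
  · rw [min_eq_right (by linarith), max_eq_right (by linarith)]

theorem locallyLipschitz_sat {M : EReal} (hM : 0 < M) : LocallyLipschitz (sat M) := by
  induction M with
  | bot => simp at hM
  | top => rw [show sat ⊤ = id from funext sat_top]; exact LocallyLipschitz.id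
  | coe M =>
    rw [show sat M = fun y => max (-M) (min M y) from
      funext (sat_coe (by exact_mod_cast hM))]
    exact (LocallyLipschitz.id.const_min M).const_max (-M)

theorem abs_sat_le {M : ℝ} (hM : 0 < M) (y : ℝ) : |sat M y| ≤ M := by
  rw [sat_coe hM, abs_le]
  exact ⟨le_max_left _ _, max_le (by linarith) (min_le_left _ _)⟩

theorem abs_sat_le_abs {M : EReal} (hM : 0 < M) (y : ℝ) : |sat M y| ≤ |y| := by
  induction M with
  | bot => simp at hM
  | top => rw [sat_top]
  | coe M =>
    have hM : 0 < M := by exact_mod_cast hM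
    rw [sat_coe hM]
    rcases le_total y M with h | h
    · rw [min_eq_right h]
      rcases le_total (-M) y with h' | h'
      · rw [max_eq_right h']
      · rw [max_eq_left h', abs_of_nonpos (by linarith), abs_of_nonpos (by linarith)]
        linarith
    · rw [min_eq_left h, max_eq_right (by linarith), abs_of_pos hM, abs_of_nonneg (by linarith)]
      exact h

variable (Ω : PhysParams) (D : DesignParams)

section Smooth

variable {Ω D}

@[fun_prop] theorem contDiff_vcd : ContDiff ℝ 1 vcd := by unfold vcd; fun_prop

@[fun_prop] theorem contDiff_vcq : ContDiff ℝ 1 vcq := by unfold vcq; fun_prop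

@[fun_prop] theorem contDiff_itd : ContDiff ℝ 1 itd := by unfold itd; fun_prop

@[fun_prop] theorem contDiff_itq : ContDiff ℝ 1 itq := by unfold itq; fun_prop

@[fun_prop] theorem contDiff_igd : ContDiff ℝ 1 igd := by unfold igd; fun_prop

@[fun_prop] theorem contDiff_igq : ContDiff ℝ 1 igq := by unfold igq; fun_prop

@[fun_prop] theorem contDiff_q₁ : ContDiff ℝ 1 q₁ := by unfold q₁; fun_prop

@[fun_prop] theorem contDiff_q₂ : ContDiff ℝ 1 q₂ := by unfold q₂; fun_prop

@[fun_prop] theorem contDiff_p₁ : ContDiff ℝ 1 p₁ := by unfold p₁; fun_prop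

@[fun_prop] theorem contDiff_p₂ : ContDiff ℝ 1 p₂ := by unfold p₂; fun_prop

@[fun_prop] theorem contDiff_actPower : ContDiff ℝ 1 actPower := by unfold actPower; fun_prop

@[fun_prop] theorem contDiff_reactPower : ContDiff ℝ 1 reactPower := by
  unfold reactPower; fun_prop

@[fun_prop] theorem contDiff_freq : ContDiff ℝ 1 (freq D) := by unfold freq; fun_prop

@[fun_prop] theorem contDiff_vcdRef : ContDiff ℝ 1 (vcdRef D) := by unfold vcdRef; fun_prop

@[fun_prop] theorem contDiff_itdRef : ContDiff ℝ 1 (itdRef Ω D) := by unfold itdRef; fun_prop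

@[fun_prop] theorem contDiff_itqRef : ContDiff ℝ 1 (itqRef Ω D) := by unfold itqRef; fun_prop

@[fun_prop] theorem contDiff_Wd : ContDiff ℝ 1 (Wd Ω D) := by unfold Wd; fun_prop

@[fun_prop] theorem contDiff_Wq : ContDiff ℝ 1 (Wq Ω D) := by unfold Wq; fun_prop

theorem contDiff_ud : ContDiff ℝ 1 fun s : State => ud Ω D s.1 s.2.1 := by unfold ud; fun_prop

theorem contDiff_vtq : ContDiff ℝ 1 fun s : State => vtq Ω D s.1 s.2.2 := by
  unfold vtq uq; fun_prop

end Smooth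

theorem locallyLipschitz_sat_comp {M : EReal} (hM : 0 < M) {f : State → ℝ} (hf : ContDiff ℝ 1 f) :
    LocallyLipschitz fun s => sat M (f s) :=
  (locallyLipschitz_sat hM).comp hf.locallyLipschitz

/-- The saturation is the only term that is not C¹, so it is split off and the rest is handled by
smoothness. -/
theorem locallyLipschitz_vtd (hD : D.Admissible) :
    LocallyLipschitz fun s : State => vtd Ω D s.1 s.2.1 := by
  unfold vtd
  refine .mul_real (.const _) (.add_real (.add_real (ContDiff.locallyLipschitz (𝕂 := ℝ) ?_)
    (.mul_real (.const _) (.sub_real (ContDiff.locallyLipschitz (𝕂 := ℝ) ?_)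
      (locallyLipschitz_sat_comp (by exact_mod_cast hD.Qbar) ?_)))) contDiff_ud.locallyLipschitz)
  all_goals fun_prop

theorem locallyLipschitz_closedLoop (hD : D.Admissible) :
    LocallyLipschitz (closedLoop Ω D 0 0) := by
  have hto : LocallyLipschitz (WithLp.toLp 2 : (Fin 10 → ℝ) → X) :=
    (PiLp.lipschitzWith_toLp 2 _).locallyLipschitz
  have hQ : (0 : EReal) < D.Qbar := by exact_mod_cast hD.Qbar
  refine (hto.comp (LocallyLipschitz.pi fun i => ?_)).prodMk (.prodMk ?_ ?_)
  · have hvtq := contDiff_vtq (Ω := Ω) (D := D)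
    fin_cases i <;> simp only [Fin.reduceFinMk, Fin.zero_eta, Fin.mk_one, Matrix.cons_val]
    -- The components that need separate treatment are those of `itd`, `q₂` and `p₂`, the only ones
    -- involving a saturation. The numbers 3, 7, 8 are positions among the goals still open.
    pick_goal 3
    · refine .sub_real (.add_real (ContDiff.locallyLipschitz (𝕂 := ℝ) ?_) (.mul_real (.const _)
        (.sub_real (locallyLipschitz_vtd Ω D hD) (ContDiff.locallyLipschitz (𝕂 := ℝ) ?_))))
        (ContDiff.locallyLipschitz (𝕂 := ℝ) ?_)
      all_goals fun_prop
    pick_goal 7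
    · refine .sub_real (ContDiff.locallyLipschitz (𝕂 := ℝ) ?_) (.mul_real (.const _)
        (.sub_real (ContDiff.locallyLipschitz (𝕂 := ℝ) ?_) (locallyLipschitz_sat_comp hQ ?_)))
      all_goals fun_prop
    pick_goal 8
    · refine .sub_real (ContDiff.locallyLipschitz (𝕂 := ℝ) ?_) (.mul_real (.const _)
        (.sub_real (ContDiff.locallyLipschitz (𝕂 := ℝ) ?_) (locallyLipschitz_sat_comp hD.Pbar ?_)))
      all_goals fun_prop
    all_goals exact ContDiff.locallyLipschitz (𝕂 := ℝ) (by fun_prop)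
  all_goals
    refine .mul_real (ContDiff.locallyLipschitz (𝕂 := ℝ) ?_)
      (.max_const (ContDiff.locallyLipschitz (𝕂 := ℝ) ?_) _)
    all_goals fun_prop

/-- The contribution of the grid voltages to the closed loop, which is additive. -/
noncomputable def gridInput (vgd vgq : ℝ) : State :=
  (WithLp.toLp 2 ![0, 0, 0, 0, -(Ω.ωb / Ω.L * vgd), -(Ω.ωb / Ω.L * vgq), 0, 0, 0, 0], 0, 0)

theorem closedLoop_eq_add_gridInput (vgd vgq : ℝ) (s : State) :
    closedLoop Ω D vgd vgq s = closedLoop Ω D 0 0 s + gridInput Ω vgd vgq := by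
  refine Prod.ext ?_ (by simp [closedLoop, gridInput])
  ext i
  fin_cases i <;> simp [closedLoop, gridInput, plant] <;> ring

/-- The grid input as a continuous linear function of the grid voltages. -/
noncomputable def gridInputCLM : ℝ × ℝ →L[ℝ] State :=
  LinearMap.toContinuousLinearMap
    { toFun := fun v => gridInput Ω v.1 v.2
      map_add' := fun v w => by
        refine Prod.ext ?_ (by simp [gridInput])
        ext i
        fin_cases i <;> simp [gridInput] <;> ring
      map_smul' := fun c v => by
        refine Prod.ext ?_ (by simp [gridInput])
        ext i
        fin_cases i <;> simp [gridInput] <;> ring }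

theorem gridInputCLM_apply (v : ℝ × ℝ) : gridInputCLM Ω v = gridInput Ω v.1 v.2 := rfl

theorem exists_primitive {v : ℝ → ℝ} (hv : MemLp v ⊤ halfLine) :
    ∃ V, IsPrimitiveOnHalfLine V v := by
  -- Extension by zero to negative times gives a locally integrable function on the line, to which
  -- Lebesgue differentiation applies.
  have hli : LocallyIntegrable ((Ici 0).indicator v) volume :=
    ((memLp_indicator_iff_restrict measurableSet_Ici).2 hv).locallyIntegrable (by simp)
  refine ⟨fun t => ∫ τ in (0 : ℝ)..t, (Ici 0).indicator v τ, by simp, fun a b => ?_, ?_⟩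
  · have hint : IntervalIntegrable ((Ici 0).indicator v) volume (min (min a b) 0)
        (max (max a b) 0) := intervalIntegrable_iff.2
      ((hli.integrableOn_isCompact isCompact_uIcc).mono_set uIoc_subset_uIcc)
    refine (hint.absolutelyContinuousOnInterval_intervalIntegral (c := 0) ?_).mono ?_
    · exact mem_uIcc.2 (Or.inl ⟨min_le_right _ _, le_max_right _ _⟩)
    · rw [uIcc, uIcc_of_le ((min_le_right _ _).trans (le_max_right _ _))]
      exact Icc_subset_Icc (min_le_left _ _) (le_max_left _ _)
  · filter_upwards [ae_restrict_of_ae (LocallyIntegrable.ae_hasDerivAt_integral hli),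
      ae_restrict_mem measurableSet_Ici] with t h1 h2
    simpa [indicator_of_mem h2] using h1 0

theorem exists_primitive_gridInput {vgd vgq : ℝ → ℝ} (hd : MemLp vgd ⊤ halfLine)
    (hq : MemLp vgq ⊤ halfLine) :
    ∃ U, IsPrimitiveOnHalfLine U fun t => gridInput Ω (vgd t) (vgq t) := by
  obtain ⟨Vd, hVd⟩ := exists_primitive hd
  obtain ⟨Vq, hVq⟩ := exists_primitive hq
  refine ⟨fun t => gridInputCLM Ω (Vd t, 0) + gridInputCLM Ω (0, Vq t), ?_, fun a b => ?_, ?_⟩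
  · simp only [hVd.zero, hVq.zero, add_zero, Prod.mk_zero_zero, map_zero]
  · exact ((by fun_prop : ContDiff ℝ 1 fun v : ℝ =>
        gridInputCLM Ω (v, 0)).comp_absolutelyContinuousOnInterval (hVd.absCont a b)).fun_add
      ((by fun_prop : ContDiff ℝ 1 fun v : ℝ =>
        gridInputCLM Ω (0, v)).comp_absolutelyContinuousOnInterval (hVq.absCont a b))
  · filter_upwards [hVd.hasDerivAt, hVq.hasDerivAt] with t h1 h2
    have h := (gridInputCLM Ω).hasFDerivAt.comp_hasDerivAt t (h1.prodMk h2)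
    refine (h.congr_deriv (gridInputCLM_apply Ω _)).congr_of_eventuallyEq (.of_forall fun τ => ?_)
    simp [← map_add]

theorem ae_abs_le_supNorm {v : ℝ → ℝ} (hv : MemLp v ⊤ halfLine) :
    ∀ᵐ t ∂volume.restrict (Ici 0), |v t| ≤ supNorm v := by
  have hfin : eLpNorm v ⊤ halfLine ≠ ⊤ := hv.eLpNorm_ne_top
  have h : ∀ᵐ t ∂halfLine, ‖v t‖ₑ ≤ eLpNorm v ⊤ halfLine := by
    rw [eLpNorm_exponent_top]; exact ae_le_eLpNormEssSup
  filter_upwards [h] with t ht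
  have := ENNReal.toNNReal_mono hfin ht
  rw [← Real.norm_eq_abs, ← coe_nnnorm]
  exact_mod_cast this

variable {Ω D} {vgd vgq : ℝ → ℝ} {s₀ : State} {I : Set ℝ} {s : ℝ → State}

theorem isSolutionOn_iff : IsSolutionOn Ω D vgd vgq s₀ I s ↔ s 0 = s₀ ∧
    IsCaratheodorySolutionOn (closedLoop Ω D 0 0) (fun t => gridInput Ω (vgd t) (vgq t)) I s := by
  constructor
  · rintro ⟨h0, h1, h2⟩
    exact ⟨h0, h1, by simpa only [← closedLoop_eq_add_gridInput] using h2⟩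
  · rintro ⟨h0, h1, h2⟩
    exact ⟨h0, h1, by simpa only [← closedLoop_eq_add_gridInput] using h2⟩

end GFM

/-! ### Error dynamics and dissipation of the energies -/

namespace GFM

section Derivatives

variable {Ω : PhysParams} {D : DesignParams} {s : ℝ → State} {t vgd vgq : ℝ}

theorem hasDerivAt_coord (h : HasDerivAt s (closedLoop Ω D vgd vgq (s t)) t) (i : Fin 10) :
    HasDerivAt (fun τ => (s τ).1 i) ((closedLoop Ω D vgd vgq (s t)).1 i) t :=
  ((EuclideanSpace.proj i : X →L[ℝ] ℝ).comp
    (ContinuousLinearMap.fst ℝ X (ℝ × ℝ))).hasFDerivAt.comp_hasDerivAt t h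

theorem hasDerivAt_vcd (h : HasDerivAt s (closedLoop Ω D vgd vgq (s t)) t) :
    HasDerivAt (fun τ => vcd (s τ).1) (Ω.ωb * freq D (s t).1 * vcq (s t).1
      + Ω.ωb / Ω.Cf * (itd (s t).1 - igd (s t).1)) t :=
  hasDerivAt_coord h 0

theorem hasDerivAt_vcq (h : HasDerivAt s (closedLoop Ω D vgd vgq (s t)) t) :
    HasDerivAt (fun τ => vcq (s τ).1) (-(Ω.ωb * freq D (s t).1 * vcd (s t).1)
      + Ω.ωb / Ω.Cf * (itq (s t).1 - igq (s t).1)) t :=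
  hasDerivAt_coord h 1

theorem hasDerivAt_itd (h : HasDerivAt s (closedLoop Ω D vgd vgq (s t)) t) :
    HasDerivAt (fun τ => itd (s τ).1) (Ω.ωb * freq D (s t).1 * itq (s t).1
      + Ω.ωb / Ω.Lf * (vtd Ω D (s t).1 (s t).2.1 - vcd (s t).1)
      - Ω.ωb * Ω.Rf / Ω.Lf * itd (s t).1) t :=
  hasDerivAt_coord h 2

theorem hasDerivAt_itq (h : HasDerivAt s (closedLoop Ω D vgd vgq (s t)) t) :
    HasDerivAt (fun τ => itq (s τ).1) (-(Ω.ωb * freq D (s t).1 * itd (s t).1)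
      + Ω.ωb / Ω.Lf * (vtq Ω D (s t).1 (s t).2.2 - vcq (s t).1)
      - Ω.ωb * Ω.Rf / Ω.Lf * itq (s t).1) t :=
  hasDerivAt_coord h 3

theorem hasDerivAt_igd (h : HasDerivAt s (closedLoop Ω D vgd vgq (s t)) t) :
    HasDerivAt (fun τ => igd (s τ).1) (Ω.ωb * freq D (s t).1 * igq (s t).1
      + Ω.ωb / Ω.L * (vcd (s t).1 - vgd) - Ω.ωb * Ω.R / Ω.L * igd (s t).1) t :=
  hasDerivAt_coord h 4

theorem hasDerivAt_igq (h : HasDerivAt s (closedLoop Ω D vgd vgq (s t)) t) :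
    HasDerivAt (fun τ => igq (s τ).1) (-(Ω.ωb * freq D (s t).1 * igd (s t).1)
      + Ω.ωb / Ω.L * (vcq (s t).1 - vgq) - Ω.ωb * Ω.R / Ω.L * igq (s t).1) t :=
  hasDerivAt_coord h 5

theorem hasDerivAt_q₁ (h : HasDerivAt s (closedLoop Ω D vgd vgq (s t)) t) :
    HasDerivAt (fun τ => q₁ (s τ).1) (q₂ (s t).1) t :=
  hasDerivAt_coord h 6

theorem hasDerivAt_q₂ (h : HasDerivAt s (closedLoop Ω D vgd vgq (s t)) t) :
    HasDerivAt (fun τ => q₂ (s τ).1) (-(2 * D.ξq * D.ωqc * q₂ (s t).1)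
      - D.ωqc ^ 2 * (q₁ (s t).1 - sat D.Qbar (reactPower (s t).1))) t :=
  hasDerivAt_coord h 7

theorem hasDerivAt_p₁ (h : HasDerivAt s (closedLoop Ω D vgd vgq (s t)) t) :
    HasDerivAt (fun τ => p₁ (s τ).1) (p₂ (s t).1) t :=
  hasDerivAt_coord h 8

theorem hasDerivAt_p₂ (h : HasDerivAt s (closedLoop Ω D vgd vgq (s t)) t) :
    HasDerivAt (fun τ => p₂ (s τ).1) (-(2 * D.ξp * D.ωpc * p₂ (s t).1)
      - D.ωpc ^ 2 * (p₁ (s t).1 - sat D.Pbar (actPower (s t).1))) t :=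
  hasDerivAt_coord h 9

theorem hasDerivAt_zd (h : HasDerivAt s (closedLoop Ω D vgd vgq (s t)) t) :
    HasDerivAt (fun τ => (s τ).2.1)
      (D.Γd * Real.exp (-(s t).2.1) * max (Wd Ω D (s t).1 - D.ε) 0) t :=
  ((ContinuousLinearMap.fst ℝ ℝ ℝ).comp
    (ContinuousLinearMap.snd ℝ X (ℝ × ℝ))).hasFDerivAt.comp_hasDerivAt t h

theorem hasDerivAt_zq (h : HasDerivAt s (closedLoop Ω D vgd vgq (s t)) t) :
    HasDerivAt (fun τ => (s τ).2.2)
      (D.Γq * Real.exp (-(s t).2.2) * max (Wq Ω D (s t).1 - D.ε) 0) t :=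
  ((ContinuousLinearMap.snd ℝ ℝ ℝ).comp
    (ContinuousLinearMap.snd ℝ X (ℝ × ℝ))).hasFDerivAt.comp_hasDerivAt t h

theorem hasDerivAt_freq (h : HasDerivAt s (closedLoop Ω D vgd vgq (s t)) t) :
    HasDerivAt (fun τ => freq D (s τ).1) (-(D.KP * p₂ (s t).1)) t :=
  ((((hasDerivAt_p₁ h).const_sub D.P₀).const_mul D.KP).const_add D.ω₀).congr_deriv (by ring)

/-- First backstepping stage: `itdRef` is the current for which rotation, grid current and the
motion of the reference cancel, leaving damping `KVC` and a coupling to the current error. -/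
theorem hasDerivAt_vcd_sub_vcdRef (hΩ : Ω.Pos)
    (h : HasDerivAt s (closedLoop Ω D vgd vgq (s t)) t) :
    HasDerivAt (fun τ => vcd (s τ).1 - vcdRef D (s τ).1)
      (Ω.ωb / Ω.Cf * (itd (s t).1 - itdRef Ω D (s t).1)
        - D.KVC * (vcd (s t).1 - vcdRef D (s t).1)) t := by
  have hr := (((hasDerivAt_q₁ h).const_sub D.Q₀).const_mul D.KQ).const_add D.V₀
  refine ((hasDerivAt_vcd h).fun_sub hr).congr_deriv ?_
  have := hΩ.ωb.ne'
  have := hΩ.Cf.ne'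
  simp only [itdRef]
  field_simp
  ring

/-- Second backstepping stage: `vtd` cancels the derivative of `itdRef` except for the part of the
grid-current derivative involving `L`, `R` and the grid voltage, which the control law does not use.
-/
theorem hasDerivAt_itd_sub_itdRef (hΩ : Ω.Pos)
    (h : HasDerivAt s (closedLoop Ω D vgd vgq (s t)) t) :
    HasDerivAt (fun τ => itd (s τ).1 - itdRef Ω D (s τ).1)
      (ud Ω D (s t).1 (s t).2.1
        + Ω.ωb / Ω.L * (vgd - vcd (s t).1 + Ω.R * igd (s t).1)) t := by
  have hr := (((hasDerivAt_igd h).fun_sub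
    (((hasDerivAt_freq h).const_mul Ω.Cf).fun_mul (hasDerivAt_vcq h))).fun_sub
    ((hasDerivAt_q₂ h).const_mul (Ω.Cf * D.KQ / Ω.ωb))).fun_sub
    ((hasDerivAt_vcd_sub_vcdRef hΩ h).const_mul (Ω.Cf * D.KVC / Ω.ωb))
  refine ((hasDerivAt_itd h).fun_sub hr).congr_deriv ?_
  have := hΩ.ωb.ne'
  have := hΩ.Cf.ne'
  have := hΩ.Lf.ne'
  have := hΩ.L.ne'
  simp only [vtd]
  -- The cancellation holds for arbitrary values of these three quantities, so they can be treated
  -- as atoms.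
  generalize ud Ω D (s t).1 (s t).2.1 = u, itdRef Ω D (s t).1 = r,
    sat D.Qbar (reactPower (s t).1) = σ
  field_simp
  ring

theorem hasDerivAt_vcq' (hΩ : Ω.Pos) (h : HasDerivAt s (closedLoop Ω D vgd vgq (s t)) t) :
    HasDerivAt (fun τ => vcq (s τ).1)
      (Ω.ωb / Ω.Cf * (itq (s t).1 - itqRef Ω D (s t).1) - D.KVC * vcq (s t).1) t := by
  refine (hasDerivAt_vcq h).congr_deriv ?_
  have := hΩ.ωb.ne'
  have := hΩ.Cf.ne'
  simp only [itqRef]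
  field_simp
  ring

theorem hasDerivAt_itq_sub_itqRef (hΩ : Ω.Pos)
    (h : HasDerivAt s (closedLoop Ω D vgd vgq (s t)) t) :
    HasDerivAt (fun τ => itq (s τ).1 - itqRef Ω D (s τ).1)
      (uq Ω D (s t).1 (s t).2.2
        + Ω.ωb / Ω.L * (vgq - vcq (s t).1 + Ω.R * igq (s t).1)) t := by
  have hr := ((hasDerivAt_igq h).fun_add
    (((hasDerivAt_freq h).const_mul Ω.Cf).fun_mul (hasDerivAt_vcd h))).fun_sub
    ((hasDerivAt_vcq' hΩ h).const_mul (Ω.Cf * D.KVC / Ω.ωb))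
  refine ((hasDerivAt_itq h).fun_sub hr).congr_deriv ?_
  have := hΩ.ωb.ne'
  have := hΩ.Cf.ne'
  have := hΩ.Lf.ne'
  have := hΩ.L.ne'
  simp only [vtq]
  generalize uq Ω D (s t).1 (s t).2.2 = u, itqRef Ω D (s t).1 = r
  field_simp
  ring

end Derivatives

/-- The dissipation estimate common to both axes: the high-gain term dominates the unmatched grid
voltage `v`. -/
theorem dissipation_le {ωb Cf L R KVC KCC μ κ g e e' vc ig v M : ℝ} (hμ : 0 < μ) (hg : 0 < g)
    (hL : 0 < L) (hV : κ ≤ KVC) (hC : κ ≤ KCC) (hv : |v| ≤ M) :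
    e * (ωb / Cf * e' - KVC * e)
      + e' * (-(KCC + (1 + g) * ωb ^ 2 / (4 * μ) * (1 + ig ^ 2 + vc ^ 2)) * e' - ωb / Cf * e
        + ωb / L * (v - vc + R * ig))
      ≤ -(2 * κ) * (1 / 2 * e ^ 2 + 1 / 2 * e' ^ 2)
        + μ * ((1 + R ^ 2 + M ^ 2) / L ^ 2) / (1 + g) := by
  set N := 1 + ig ^ 2 + vc ^ 2 with hN
  have hv2 : v ^ 2 ≤ M ^ 2 := sq_le_sq' (by linarith [(abs_le.1 hv).1]) (abs_le.1 hv).2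
  -- Cauchy–Schwarz for `(v, -1, R)` and `(1, vc, ig)`; the hints are the squares in Lagrange's
  -- identity.
  have hcs : (v - vc + R * ig) ^ 2 ≤ (1 + R ^ 2 + M ^ 2) * N := by
    have h1 : (v - vc + R * ig) ^ 2 ≤ (1 + R ^ 2 + v ^ 2) * N := by
      nlinarith [sq_nonneg (v * vc + 1), sq_nonneg (v * ig - R), sq_nonneg (ig + R * vc)]
    exact h1.trans (by gcongr)
  -- Young's inequality weighted so that the `e' ^ 2` term is exactly the high-gain damping; `N`
  -- cancels from the remainder by `hcs`.
  have hy : ωb / L * e' * (v - vc + R * ig) ≤ (1 + g) * ωb ^ 2 / (4 * μ) * N * e' ^ 2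
      + μ * ((1 + R ^ 2 + M ^ 2) / L ^ 2) / (1 + g) := by
    have hNpos : 0 < N := by positivity
    set y := v - vc + R * ig
    have h2 : μ * (y ^ 2 / N / L ^ 2) / (1 + g) ≤ μ * ((1 + R ^ 2 + M ^ 2) / L ^ 2) / (1 + g) := by
      gcongr
      rwa [div_le_iff₀ hNpos]
    have h3 : 0 ≤ (1 + g) * ωb ^ 2 / (4 * μ) * N * e' ^ 2 + μ * (y ^ 2 / N / L ^ 2) / (1 + g)
        - ωb / L * e' * y := by
      have : (1 + g) * ωb ^ 2 / (4 * μ) * N * e' ^ 2 + μ * (y ^ 2 / N / L ^ 2) / (1 + g)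
        - ωb / L * e' * y = ((1 + g) * ωb * N * L * e' - 2 * μ * y) ^ 2
          / (4 * μ * (1 + g) * N * L ^ 2) := by
        have : (1 + g) ≠ 0 := by positivity
        field_simp
        ring
      rw [this]; positivity
    linarith
  -- The two coupling terms `± ωb / Cf * e * e'` cancel.
  nlinarith [mul_nonneg (sub_nonneg.2 hV) (sq_nonneg e),
    mul_nonneg (sub_nonneg.2 hC) (sq_nonneg e')]

section Energy

variable {Ω : PhysParams} {D : DesignParams} {s : ℝ → State} {t vgd vgq M : ℝ}

theorem exists_hasDerivAt_Wd_le (hD : D.Admissible) (hΩ : Ω.Pos) (hM : |vgd| ≤ M)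
    (h : HasDerivAt s (closedLoop Ω D vgd vgq (s t)) t) :
    ∃ W', HasDerivAt (fun τ => Wd Ω D (s τ).1) W' t ∧
      W' ≤ -(2 * min D.KVC D.KCC) * Wd Ω D (s t).1
        + D.μd * ((1 + Ω.R ^ 2 + M ^ 2) / Ω.L ^ 2) / (1 + Real.exp (s t).2.1) := by
  refine ⟨_, (((hasDerivAt_vcd_sub_vcdRef hΩ h).fun_pow 2).const_mul (1 / 2)).fun_add
    (((hasDerivAt_itd_sub_itdRef hΩ h).fun_pow 2).const_mul (1 / 2)), le_trans (le_of_eq ?_)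
    (dissipation_le (ωb := Ω.ωb) (Cf := Ω.Cf) (vc := vcd (s t).1) (ig := igd (s t).1) hD.μd
      (Real.exp_pos _) hΩ.L (min_le_left _ _) (min_le_right _ _) hM)⟩
  simp only [ud]
  ring

theorem exists_hasDerivAt_Wq_le (hD : D.Admissible) (hΩ : Ω.Pos) (hM : |vgq| ≤ M)
    (h : HasDerivAt s (closedLoop Ω D vgd vgq (s t)) t) :
    ∃ W', HasDerivAt (fun τ => Wq Ω D (s τ).1) W' t ∧
      W' ≤ -(2 * min D.KVC D.KCC) * Wq Ω D (s t).1
        + D.μq * ((1 + Ω.R ^ 2 + M ^ 2) / Ω.L ^ 2) / (1 + Real.exp (s t).2.2) := by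
  refine ⟨_, (((hasDerivAt_vcq' hΩ h).fun_pow 2).const_mul (1 / 2)).fun_add
    (((hasDerivAt_itq_sub_itqRef hΩ h).fun_pow 2).const_mul (1 / 2)), le_trans (le_of_eq ?_)
    (dissipation_le (ωb := Ω.ωb) (Cf := Ω.Cf) (vc := vcq (s t).1) (ig := igq (s t).1) hD.μq
      (Real.exp_pos _) hΩ.L (min_le_left _ _) (min_le_right _ _) hM)⟩
  simp only [uq]
  ring

end Energy

end GFM

/-! ### Scalar bounds: adaptive gain and second-order filter -/

namespace GFM

/-- Boundedness of the energy and of the gain for an adaptation law with dead zone. -/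
theorem adaptive_gain_bounds {W z : ℝ → ℝ} {T κ b Γ ε : ℝ} (hT : 0 ≤ T) (hκ : 0 < κ) (hb : 0 ≤ b)
    (hΓ : 0 < Γ) (hε : 0 < ε) (hW : AbsolutelyContinuousOnInterval W 0 T)
    (hz : AbsolutelyContinuousOnInterval z 0 T)
    (hWd : ∀ᵐ t ∂volume.restrict (Icc 0 T), ∃ W', HasDerivAt W W' t ∧
      W' ≤ -κ * W t + b / (1 + Real.exp (z t)))
    (hzd : ∀ᵐ t ∂volume.restrict (Icc 0 T),
      HasDerivAt z (Γ * Real.exp (-z t) * max (W t - ε) 0) t) :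
    W T ≤ max (W 0) (b / κ) ∧ z 0 ≤ z T ∧
      Real.exp (z T) ≤ max (Real.exp (z 0)) (b / (κ * ε)) + Γ / κ * max (W 0) (b / κ) := by
  have hu : uIcc 0 T = Icc 0 T := uIcc_of_le hT
  have acmono : ∀ {f : ℝ → ℝ}, AbsolutelyContinuousOnInterval f 0 T → ∀ a ∈ Icc 0 T,
      ∀ c ∈ Icc 0 T, AbsolutelyContinuousOnInterval f a c := fun hf a ha c hc =>
    hf.mono (by rw [hu]; exact uIcc_subset_Icc ha hc)
  have hWle : ∀ t ∈ Icc 0 T, W t ≤ max (W 0) (b / κ) := fun t ht =>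
    (acmono hW 0 (left_mem_Icc.2 hT) t ht).le_max_of_ae_deriv_le ht.1 hκ (by
      filter_upwards [ae_restrict_Icc_mono hWd le_rfl ht.2]
      rintro τ ⟨W', h1, h2⟩
      refine ⟨W', h1, h2.trans (add_le_add le_rfl ?_)⟩
      exact div_le_self hb (by linarith [Real.exp_pos (z τ)]))
  have hmono : MonotoneOn z (Icc 0 T) := monotoneOn_of_ae_deriv_nonneg ordConnected_Icc
    (acmono hz) (by
      filter_upwards [hzd] with t ht
      exact ⟨_, ht, by positivity⟩)
  refine ⟨hWle T (right_mem_Icc.2 hT), hmono (left_mem_Icc.2 hT) (right_mem_Icc.2 hT) hT, ?_⟩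
  set Wm := max (W 0) (b / κ)
  -- Above the level `b / (κ * ε)` the forcing of `W` is at most `κ * ε`, so its equilibrium lies in
  -- the dead zone. Including `exp (z 0)` lets the intermediate value theorem find a time at which
  -- the gain equals `G`.
  set G := max (Real.exp (z 0)) (b / (κ * ε))
  have hWm : 0 ≤ Wm := le_max_of_le_right (by positivity)
  by_cases hG : Real.exp (z T) ≤ G
  · exact hG.trans (le_add_of_nonneg_right (by positivity))
  have hgac : AbsolutelyContinuousOnInterval (fun t => Real.exp (z t)) 0 T :=
    Real.contDiff_exp.comp_absolutelyContinuousOnInterval hz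
  obtain ⟨t₁, ht₁, hgt₁⟩ := intermediate_value_Icc hT (hu ▸ hgac.continuousOn)
    (show G ∈ Icc _ _ from ⟨le_max_left _ _, (not_le.1 hG).le⟩)
  simp only at hgt₁
  have hsmall : ∀ t ∈ Icc t₁ T, b / (1 + Real.exp (z t)) ≤ κ * ε := fun t ht => by
    have h1 : G ≤ Real.exp (z t) := hgt₁ ▸ Real.exp_le_exp.2
      (hmono ht₁ ⟨ht₁.1.trans ht.1, ht.2⟩ ht.1)
    have h2 : b / (κ * ε) ≤ Real.exp (z t) := (le_max_right _ _).trans h1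
    rw [div_le_iff₀ (by positivity)] at h2 ⊢
    nlinarith [mul_pos hκ hε]
  have hdecay : ∀ t ∈ Icc t₁ T, max (W t - ε) 0 ≤ Wm * Real.exp (-κ * (t - t₁)) := fun t ht => by
    have ht' : t ∈ Icc 0 T := ⟨ht₁.1.trans ht.1, ht.2⟩
    have h1 := (acmono hW t₁ ht₁ t ht').sub_le_exp_of_ae_deriv_le ht.1 hκ (b := κ * ε) (by
      filter_upwards [ae_restrict_Icc_mono hWd ht₁.1 ht.2, ae_restrict_mem measurableSet_Icc]
      rintro τ ⟨W', h1, h2⟩ h3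
      exact ⟨W', h1, h2.trans (add_le_add le_rfl (hsmall τ ⟨h3.1, h3.2.trans ht.2⟩))⟩)
    rw [mul_div_cancel_left₀ _ hκ.ne'] at h1
    refine max_le (h1.trans ?_) (by positivity)
    gcongr
    linarith [hWle t₁ ht₁]
  -- The added exponential is the integral from `t` to infinity of the bound on `(exp z)'`, so the
  -- sum does not increase.
  have hac : AbsolutelyContinuousOnInterval
      (fun t => Real.exp (z t) + Γ / κ * Wm * Real.exp (-κ * (t - t₁))) t₁ T :=
    (acmono hgac t₁ ht₁ T (right_mem_Icc.2 hT)).fun_add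
      (ContDiffOn.absolutelyContinuousOnInterval (by fun_prop))
  have key := hac.le_of_ae_deriv_nonpos ht₁.2 (by
    filter_upwards [ae_restrict_Icc_mono hzd ht₁.1 le_rfl, ae_restrict_mem measurableSet_Icc]
      with t h1 h2
    refine ⟨_, h1.exp.fun_add
      (((((hasDerivAt_id t).sub_const t₁).const_mul (-κ)).exp).const_mul (Γ / κ * Wm)), ?_⟩
    have h3 := mul_le_mul_of_nonneg_left (hdecay t h2) hΓ.le
    have h4 : Real.exp (z t) * (Γ * Real.exp (-z t) * max (W t - ε) 0)
        = Γ * max (W t - ε) 0 := by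
      rw [Real.exp_neg]; field
    have h5 : Γ / κ * Wm * (Real.exp (-κ * (t - t₁)) * (-κ * 1))
        = -(Γ * (Wm * Real.exp (-κ * (t - t₁)))) := by field
    simp only [id_eq]
    rw [h4, h5]
    linarith)
  simp only [sub_self, mul_zero, Real.exp_zero, mul_one, hgt₁] at key
  have : 0 ≤ Γ / κ * Wm * Real.exp (-κ * (T - t₁)) := by positivity
  linarith

/-- An overdamped second-order filter with bounded input has bounded states. -/
theorem exists_filter_bound {ξ ω : ℝ} (hξ : 1 < ξ) (hω : 0 < ω) (M β : ℝ) :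
    ∃ C, ∀ (x₁ x₂ u : ℝ → ℝ) (T : ℝ), 0 ≤ T → |x₁ 0| ≤ M → |x₂ 0| ≤ M →
      AbsolutelyContinuousOnInterval x₁ 0 T → AbsolutelyContinuousOnInterval x₂ 0 T →
      (∀ t ∈ Icc 0 T, |u t| ≤ β) →
      (∀ᵐ t ∂volume.restrict (Icc 0 T), HasDerivAt x₁ (x₂ t) t) →
      (∀ᵐ t ∂volume.restrict (Icc 0 T),
        HasDerivAt x₂ (-(2 * ξ * ω * x₂ t) - ω ^ 2 * (x₁ t - u t)) t) →
      |x₁ T| ≤ C ∧ |x₂ T| ≤ C := by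
  have hr : 0 < ξ ^ 2 - 1 := by nlinarith
  have hrs := Real.sq_sqrt hr.le
  set r := Real.sqrt (ξ ^ 2 - 1)
  have hr0 : 0 ≤ r := Real.sqrt_nonneg _
  -- `-l` and `-m` are the roots of `X ^ 2 + 2 * ξ * ω * X + ω ^ 2`, real and negative because `ξ >
  -- 1`.
  set l := ω * (ξ - r) with hl
  set m := ω * (ξ + r) with hm
  have hl0 : 0 < l := mul_pos hω (by nlinarith)
  have hm0 : 0 < m := mul_pos hω (by linarith)
  have hsum : l + m = 2 * ξ * ω := by rw [hl, hm]; ring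
  have hprod : l * m = ω ^ 2 := by
    have : l * m = ω ^ 2 * (ξ ^ 2 - r ^ 2) := by rw [hl, hm]; ring
    rw [this, hrs]; ring
  set A := max (M + l * M) (ω ^ 2 * β / m)
  refine ⟨max M (A / l) + (A + l * max M (A / l)),
    fun x₁ x₂ u T hT h₁ h₂ ac₁ ac₂ hu d₁ d₂ => ?_⟩
  have hM : 0 ≤ M := (abs_nonneg _).trans h₁
  -- Factoring the filter: `η = x₂ + l * x₁` satisfies `η' = -m * η + ω ^ 2 * u`, and then `x₁' = -l
  -- * x₁ + η`.
  have hη : ∀ t ∈ Icc 0 T, |x₂ t + l * x₁ t| ≤ A := fun t ht => by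
    have hac : AbsolutelyContinuousOnInterval (fun t => x₂ t + l * x₁ t) 0 t :=
      (ac₂.fun_add (ac₁.const_mul l)).mono (by
        rw [uIcc_of_le hT, uIcc_of_le ht.1]; exact Icc_subset_Icc le_rfl ht.2)
    refine (hac.abs_le_max_of_ae_deriv_eq (g := fun t => ω ^ 2 * u t) (β := ω ^ 2 * β) ht.1 hm0
      (fun τ hτ => ?_) ?_).trans (max_le_max ?_ le_rfl)
    · rw [abs_mul, abs_of_nonneg (by positivity : 0 ≤ ω ^ 2)]
      gcongr
      exact hu τ ⟨hτ.1, hτ.2.trans ht.2⟩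
    · filter_upwards [ae_restrict_Icc_mono d₁ le_rfl ht.2, ae_restrict_Icc_mono d₂ le_rfl ht.2]
        with τ e₁ e₂
      refine (e₂.fun_add (e₁.const_mul l)).congr_deriv ?_
      rw [← hsum, ← hprod]; ring
    · refine (abs_add_le _ _).trans ?_
      rw [abs_mul, abs_of_pos hl0]
      gcongr
  have hx₁ : |x₁ T| ≤ max M (A / l) := by
    refine (ac₁.abs_le_max_of_ae_deriv_eq (g := fun t => x₂ t + l * x₁ t) hT hl0 hη ?_).trans
      (max_le_max h₁ le_rfl)
    filter_upwards [d₁] with t e₁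
    exact e₁.congr_deriv (by ring)
  have hA : 0 ≤ A := le_max_of_le_left (by positivity)
  have hB : 0 ≤ max M (A / l) := le_max_of_le_left hM
  have hηT := hη T (right_mem_Icc.2 hT)
  constructor
  · have : 0 ≤ l * max M (A / l) := by positivity
    linarith
  · have h : x₂ T = (x₂ T + l * x₁ T) - l * x₁ T := by ring
    rw [h]
    refine (abs_sub _ _).trans ?_
    rw [abs_mul, abs_of_pos hl0]
    have := mul_le_mul_of_nonneg_left hx₁ hl0.le
    linarith

end GFM

/-! ### Uniform boundedness of all states -/

namespace GFM

variable {Ω : PhysParams} {D : DesignParams}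

/-- `s` solves the closed loop on `[0, T]` for some grid voltages bounded by `M`, from an initial
state bounded by `M`. -/
structure IsBoundedDataSolution (Ω : PhysParams) (D : DesignParams) (M T : ℝ) (s : ℝ → State) :
    Prop where
  nonneg : 0 ≤ T
  init : ‖s 0‖ ≤ M
  absCont : AbsolutelyContinuousOnInterval s 0 T
  ode : ∀ᵐ t ∂volume.restrict (Icc 0 T), ∃ vgd vgq : ℝ, |vgd| ≤ M ∧ |vgq| ≤ M ∧
    HasDerivAt s (closedLoop Ω D vgd vgq (s t)) t

/-- Uniform bounds are stated at the final time only; restriction supplies them at all earlier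
times. -/
theorem IsBoundedDataSolution.restrict {M T t : ℝ} {s : ℝ → State}
    (h : IsBoundedDataSolution Ω D M T s) (ht : t ∈ Icc 0 T) :
    IsBoundedDataSolution Ω D M t s :=
  ⟨ht.1, h.init, h.absCont.mono (by
    rw [uIcc_of_le ht.1, uIcc_of_le h.nonneg]; exact Icc_subset_Icc le_rfl ht.2),
    ae_restrict_Icc_mono h.ode le_rfl ht.2⟩

theorem IsBoundedDataSolution.comp_absCont {M T : ℝ} {s : ℝ → State}
    (h : IsBoundedDataSolution Ω D M T s) {f : State → ℝ} (hf : ContDiff ℝ 1 f) :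
    AbsolutelyContinuousOnInterval (fun t => f (s t)) 0 T :=
  hf.comp_absolutelyContinuousOnInterval h.absCont

/-- The signal `f` is bounded along solutions, uniformly in time and for bounded data. -/
def IsUniformlyBounded (Ω : PhysParams) (D : DesignParams) (f : State → ℝ) : Prop :=
  ∀ M, ∃ C, ∀ T s, IsBoundedDataSolution Ω D M T s → |f (s T)| ≤ C

namespace IsUniformlyBounded

variable {f g : State → ℝ}

theorem const (c : ℝ) : IsUniformlyBounded Ω D fun _ => c := fun _ => ⟨|c|, fun _ _ _ => le_rfl⟩

theorem add (hf : IsUniformlyBounded Ω D f) (hg : IsUniformlyBounded Ω D g) :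
    IsUniformlyBounded Ω D fun x => f x + g x := fun M =>
  let ⟨C, hC⟩ := hf M
  let ⟨C', hC'⟩ := hg M
  ⟨C + C', fun T s h => (abs_add_le _ _).trans (add_le_add (hC T s h) (hC' T s h))⟩

theorem mul (hf : IsUniformlyBounded Ω D f) (hg : IsUniformlyBounded Ω D g) :
    IsUniformlyBounded Ω D fun x => f x * g x := fun M =>
  let ⟨C, hC⟩ := hf M
  let ⟨C', hC'⟩ := hg M
  ⟨C * C', fun T s h => (abs_mul _ _).trans_le (mul_le_mul (hC T s h) (hC' T s h)
    (abs_nonneg _) ((abs_nonneg _).trans (hC T s h)))⟩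

theorem sub (hf : IsUniformlyBounded Ω D f) (hg : IsUniformlyBounded Ω D g) :
    IsUniformlyBounded Ω D fun x => f x - g x := fun M =>
  let ⟨C, hC⟩ := hf M
  let ⟨C', hC'⟩ := hg M
  ⟨C + C', fun T s h => (abs_sub _ _).trans (add_le_add (hC T s h) (hC' T s h))⟩

theorem of_abs_le (hf : IsUniformlyBounded Ω D f) (h : ∀ x, |g x| ≤ |f x|) :
    IsUniformlyBounded Ω D g := fun M =>
  let ⟨C, hC⟩ := hf M
  ⟨C, fun T s hs => (h _).trans (hC T s hs)⟩

theorem congr (hf : IsUniformlyBounded Ω D f) (h : ∀ x, g x = f x) : IsUniformlyBounded Ω D g :=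
  hf.of_abs_le fun x => (congrArg abs (h x)).le

/-- A signal is bounded if its square is at most twice a bounded signal. -/
theorem of_sq_le (hf : IsUniformlyBounded Ω D f) (h : ∀ x, g x ^ 2 ≤ 2 * f x) :
    IsUniformlyBounded Ω D g := by
  refine ((const 1).add ((const 2).mul hf)).of_abs_le fun x => ?_
  have h1 := h x
  rw [abs_of_nonneg (a := 1 + 2 * f x) (by nlinarith [sq_nonneg (g x)]), abs_le]
  constructor <;> nlinarith [sq_nonneg (g x + 1), sq_nonneg (g x - 1)]

end IsUniformlyBounded

theorem exists_initial_bound {f : State → ℝ} (hf : Continuous f) (M : ℝ) :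
    ∃ C, 0 ≤ C ∧ ∀ x, ‖x‖ ≤ M → |f x| ≤ C := by
  obtain ⟨C, hC⟩ := (isCompact_closedBall (0 : State) M).exists_bound_of_continuousOn
    hf.continuousOn
  exact ⟨max C 0, le_max_right _ _, fun x hx => le_max_of_le_left (hC x (by simpa using hx))⟩

/-- The scalar bounds depend on the initial state only through `W` and `z`, which are bounded on the
ball of radius `M`. Monotonicity bounds the gain from below; the bound on `exp z` controls it from
above. -/
theorem isUniformlyBounded_energy_and_gain {W z : State → ℝ} {κ Γ ε : ℝ} {b : ℝ → ℝ}
    (hW : ContDiff ℝ 1 W) (hz : ContDiff ℝ 1 z) (hκ : 0 < κ) (hΓ : 0 < Γ) (hε : 0 < ε)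
    (hb : ∀ M, 0 ≤ b M) (hWpos : ∀ x, 0 ≤ W x)
    (h : ∀ (M : ℝ) (s : ℝ → State) (t vgd vgq : ℝ), |vgd| ≤ M → |vgq| ≤ M →
      HasDerivAt s (closedLoop Ω D vgd vgq (s t)) t →
      (∃ W', HasDerivAt (fun τ => W (s τ)) W' t ∧
        W' ≤ -κ * W (s t) + b M / (1 + Real.exp (z (s t)))) ∧
      HasDerivAt (fun τ => z (s τ)) (Γ * Real.exp (-z (s t)) * max (W (s t) - ε) 0) t) :
    IsUniformlyBounded Ω D W ∧ IsUniformlyBounded Ω D z := by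
  have key : ∀ M T s, IsBoundedDataSolution Ω D M T s →
      W (s T) ≤ max (W (s 0)) (b M / κ) ∧ z (s 0) ≤ z (s T) ∧
      Real.exp (z (s T)) ≤ max (Real.exp (z (s 0))) (b M / (κ * ε))
        + Γ / κ * max (W (s 0)) (b M / κ) := fun M T s hs =>
    adaptive_gain_bounds (W := fun t => W (s t)) (z := fun t => z (s t)) hs.nonneg hκ (hb M) hΓ hε
      (hs.comp_absCont hW) (hs.comp_absCont hz)
      (by filter_upwards [hs.ode]
          rintro t ⟨vgd, vgq, h1, h2, h3⟩
          exact (h M s t vgd vgq h1 h2 h3).1)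
      (by filter_upwards [hs.ode]
          rintro t ⟨vgd, vgq, h1, h2, h3⟩
          exact (h M s t vgd vgq h1 h2 h3).2)
  constructor <;> intro M
  · obtain ⟨C, hC0, hC⟩ := exists_initial_bound hW.continuous M
    refine ⟨max C (b M / κ), fun T s hs => ?_⟩
    rw [abs_of_nonneg (hWpos _)]
    exact (key M T s hs).1.trans (max_le_max ((le_abs_self _).trans (hC _ hs.init)) le_rfl)
  · obtain ⟨C, hC0, hC⟩ := exists_initial_bound hW.continuous M
    obtain ⟨C', hC'0, hC'⟩ := exists_initial_bound hz.continuous M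
    set S := max (Real.exp C') (b M / (κ * ε)) + Γ / κ * max C (b M / κ)
    refine ⟨max C' S, fun T s hs => abs_le'.2 ⟨?_, ?_⟩⟩
    · have h1 := (key M T s hs).2.2
      have h2 : W (s 0) ≤ C := (le_abs_self _).trans (hC _ hs.init)
      have h3 : z (s 0) ≤ C' := (le_abs_self _).trans (hC' _ hs.init)
      have h4 : Real.exp (z (s T)) ≤ S := h1.trans
        (add_le_add (max_le_max (Real.exp_le_exp.2 h3) le_rfl)
          (mul_le_mul_of_nonneg_left (max_le_max h2 le_rfl) (by positivity)))
      exact le_max_of_le_right (by linarith [Real.add_one_le_exp (z (s T))])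
    · have h1 := (key M T s hs).2.1
      have h3 : -z (s 0) ≤ C' := (neg_le_abs _).trans (hC' _ hs.init)
      exact le_max_of_le_left (by linarith)

theorem isUniformlyBounded_d (hD : D.Admissible) (hΩ : Ω.Pos) :
    IsUniformlyBounded Ω D (fun s => Wd Ω D s.1) ∧ IsUniformlyBounded Ω D (fun s => s.2.1) := by
  refine isUniformlyBounded_energy_and_gain (κ := 2 * min D.KVC D.KCC) (Γ := D.Γd) (ε := D.ε)
    (b := fun M => D.μd * ((1 + Ω.R ^ 2 + M ^ 2) / Ω.L ^ 2)) (by fun_prop) (by fun_prop)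
    (mul_pos two_pos (lt_min hD.KVC hD.KCC)) hD.Γd hD.ε (fun M => ?_) (fun x => ?_)
    fun M s t vgd vgq h1 _ h3 => ⟨exists_hasDerivAt_Wd_le hD hΩ h1 h3, hasDerivAt_zd h3⟩
  · have := hD.μd
    positivity
  · simp only [Wd]; positivity

theorem isUniformlyBounded_q (hD : D.Admissible) (hΩ : Ω.Pos) :
    IsUniformlyBounded Ω D (fun s => Wq Ω D s.1) ∧ IsUniformlyBounded Ω D (fun s => s.2.2) := by
  refine isUniformlyBounded_energy_and_gain (κ := 2 * min D.KVC D.KCC) (Γ := D.Γq) (ε := D.ε)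
    (b := fun M => D.μq * ((1 + Ω.R ^ 2 + M ^ 2) / Ω.L ^ 2)) (by fun_prop) (by fun_prop)
    (mul_pos two_pos (lt_min hD.KVC hD.KCC)) hD.Γq hD.ε (fun M => ?_) (fun x => ?_)
    fun M s t vgd vgq _ h2 h3 => ⟨exists_hasDerivAt_Wq_le hD hΩ h2 h3, hasDerivAt_zq h3⟩
  · have := hD.μq
    positivity
  · simp only [Wq]; positivity

theorem isUniformlyBounded_filter {x₁ x₂ u : State → ℝ} {ξ ω : ℝ} (hξ : 1 < ξ) (hω : 0 < ω)
    (h₁ : ContDiff ℝ 1 x₁) (h₂ : ContDiff ℝ 1 x₂) (hu : IsUniformlyBounded Ω D u)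
    (h : ∀ (s : ℝ → State) (t vgd vgq : ℝ), HasDerivAt s (closedLoop Ω D vgd vgq (s t)) t →
      HasDerivAt (fun τ => x₁ (s τ)) (x₂ (s t)) t ∧
      HasDerivAt (fun τ => x₂ (s τ))
        (-(2 * ξ * ω * x₂ (s t)) - ω ^ 2 * (x₁ (s t) - u (s t))) t) :
    IsUniformlyBounded Ω D x₁ ∧ IsUniformlyBounded Ω D x₂ := by
  have key : ∀ M, ∃ C, ∀ T s, IsBoundedDataSolution Ω D M T s →
      |x₁ (s T)| ≤ C ∧ |x₂ (s T)| ≤ C := fun M => by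
    obtain ⟨C₁, -, hC₁⟩ := exists_initial_bound h₁.continuous M
    obtain ⟨C₂, -, hC₂⟩ := exists_initial_bound h₂.continuous M
    obtain ⟨β, hβ⟩ := hu M
    obtain ⟨C, hC⟩ := exists_filter_bound hξ hω (max C₁ C₂) β
    refine ⟨C, fun T s hs => hC (fun t => x₁ (s t)) (fun t => x₂ (s t)) (fun t => u (s t)) T
      hs.nonneg (le_max_of_le_left (hC₁ _ hs.init)) (le_max_of_le_right (hC₂ _ hs.init))
      (hs.comp_absCont h₁) (hs.comp_absCont h₂) (fun t ht => hβ t s (hs.restrict ht)) ?_ ?_⟩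
    all_goals
      filter_upwards [hs.ode]
      rintro t ⟨vgd, vgq, -, -, h3⟩
    exacts [(h s t vgd vgq h3).1, (h s t vgd vgq h3).2]
  exact ⟨fun M => (key M).imp fun C hC T s hs => (hC T s hs).1,
    fun M => (key M).imp fun C hC T s hs => (hC T s hs).2⟩

/-- In the derivative of the current energy the rotation terms cancel. Half of the resistive damping
absorbs the voltages by Young's inequality; the other half is `-(ωb * R / L)` times the energy. -/
theorem isUniformlyBounded_gridCurrent (hΩ : Ω.Pos)
    (hd : IsUniformlyBounded Ω D fun s => vcd s.1) (hq : IsUniformlyBounded Ω D fun s => vcq s.1) :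
    IsUniformlyBounded Ω D fun s => 1 / 2 * (igd s.1 ^ 2 + igq s.1 ^ 2) := fun M => by
  obtain ⟨Cd, hCd⟩ := hd M
  obtain ⟨Cq, hCq⟩ := hq M
  have hac : ContDiff ℝ 1 fun s : State => 1 / 2 * (igd s.1 ^ 2 + igq s.1 ^ 2) := by fun_prop
  obtain ⟨C₀, -, hC₀⟩ := exists_initial_bound hac.continuous M
  have hω := hΩ.ωb
  have hL := hΩ.L
  have hR := hΩ.R
  set c := Ω.ωb / (2 * Ω.L * Ω.R) * ((Cd + M) ^ 2 + (Cq + M) ^ 2) with hc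
  refine ⟨max C₀ (c / (Ω.ωb * Ω.R / Ω.L)), fun T s hs => ?_⟩
  rw [abs_of_nonneg (by positivity)]
  refine ((hs.comp_absCont hac).le_max_of_ae_deriv_le (b := c) hs.nonneg
    (by positivity : 0 < Ω.ωb * Ω.R / Ω.L) ?_).trans
    (max_le_max ((le_abs_self _).trans (hC₀ _ hs.init)) le_rfl)
  filter_upwards [hs.ode, ae_restrict_mem measurableSet_Icc]
  rintro t ⟨vgd, vgq, h1, h2, h3⟩ ht
  refine ⟨_, (((hasDerivAt_igd h3).fun_pow 2).fun_add
    ((hasDerivAt_igq h3).fun_pow 2)).const_mul (1 / 2), ?_⟩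
  have young : ∀ i w K : ℝ, |w| ≤ K →
      i * w ≤ Ω.R / 2 * i ^ 2 + 1 / (2 * Ω.R) * K ^ 2 := fun i w K hw => by
    have hwK : w ^ 2 ≤ K ^ 2 := sq_le_sq' (by linarith [(abs_le.1 hw).1]) (abs_le.1 hw).2
    have h4 : Ω.R / 2 * i ^ 2 + 1 / (2 * Ω.R) * w ^ 2 - i * w
        = (Ω.R * i - w) ^ 2 / (2 * Ω.R) := by field
    have h5 : 0 ≤ (Ω.R * i - w) ^ 2 / (2 * Ω.R) := by positivity
    have h6 : 1 / (2 * Ω.R) * w ^ 2 ≤ 1 / (2 * Ω.R) * K ^ 2 := by gcongr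
    linarith
  have yd := young (igd (s t).1) (vcd (s t).1 - vgd) (Cd + M)
    ((abs_sub _ _).trans (add_le_add (hCd t s (hs.restrict ht)) h1))
  have yq := young (igq (s t).1) (vcq (s t).1 - vgq) (Cq + M)
    ((abs_sub _ _).trans (add_le_add (hCq t s (hs.restrict ht)) h2))
  have hωL : 0 < Ω.ωb / Ω.L := by positivity
  have hsum := mul_le_mul_of_nonneg_left (add_le_add yd yq) hωL.le
  refine le_trans (le_of_eq ?_) ((add_le_add_left hsum
    (-(Ω.ωb * Ω.R / Ω.L) * (igd (s t).1 ^ 2 + igq (s t).1 ^ 2))).trans (le_of_eq ?_))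
  · simp only [Nat.cast_ofNat]
    ring
  · rw [hc]
    field

/-- The order matters. The voltage reference depends on `q₁`, which is driven by a power that
depends on the voltages; finiteness of `Qbar` breaks this circle. The active power is treated after
voltages and grid currents are bounded, so `Pbar = ⊤` is harmless. -/
theorem isUniformlyBounded_coord (hD : D.Admissible) (hΩ : Ω.Pos) (i : Fin 10) :
    IsUniformlyBounded Ω D fun s => s.1 i := by
  have hWd := (isUniformlyBounded_d hD hΩ).1
  have hWq := (isUniformlyBounded_q hD hΩ).1
  have evd : IsUniformlyBounded Ω D fun s => vcd s.1 - vcdRef D s.1 := hWd.of_sq_le fun x => by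
    simp only [Wd]; nlinarith [sq_nonneg (itd x.1 - itdRef Ω D x.1)]
  have eid : IsUniformlyBounded Ω D fun s => itd s.1 - itdRef Ω D s.1 := hWd.of_sq_le fun x => by
    simp only [Wd]; nlinarith [sq_nonneg (vcd x.1 - vcdRef D x.1)]
  have hvcq : IsUniformlyBounded Ω D fun s => vcq s.1 := hWq.of_sq_le fun x => by
    simp only [Wq]; nlinarith [sq_nonneg (itq x.1 - itqRef Ω D x.1)]
  have eiq : IsUniformlyBounded Ω D fun s => itq s.1 - itqRef Ω D s.1 := hWq.of_sq_le fun x => by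
    simp only [Wq]; nlinarith [sq_nonneg (vcq x.1)]
  have hsatQ : IsUniformlyBounded Ω D fun s => sat D.Qbar (reactPower s.1) :=
    (IsUniformlyBounded.const D.Qbar).of_abs_le fun x =>
      (abs_sat_le hD.Qbar _).trans (le_abs_self _)
  obtain ⟨hq₁, hq₂⟩ := isUniformlyBounded_filter (x₁ := fun s => q₁ s.1) (x₂ := fun s => q₂ s.1)
    hD.ξq hD.ωqc (by fun_prop) (by fun_prop) hsatQ
    fun s t vgd vgq h => ⟨hasDerivAt_q₁ h, hasDerivAt_q₂ h⟩
  have hvref : IsUniformlyBounded Ω D fun s => vcdRef D s.1 :=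
    (IsUniformlyBounded.const D.V₀).add ((IsUniformlyBounded.const D.KQ).mul
      ((IsUniformlyBounded.const D.Q₀).sub hq₁))
  have hvcd : IsUniformlyBounded Ω D fun s => vcd s.1 := (evd.add hvref).congr fun x => by ring
  have hig := isUniformlyBounded_gridCurrent hΩ hvcd hvcq
  have higd : IsUniformlyBounded Ω D fun s => igd s.1 := hig.of_sq_le fun x => by
    nlinarith [sq_nonneg (igq x.1)]
  have higq : IsUniformlyBounded Ω D fun s => igq s.1 := hig.of_sq_le fun x => by
    nlinarith [sq_nonneg (igd x.1)]
  have hP : IsUniformlyBounded Ω D fun s => actPower s.1 := (hvcd.mul higd).add (hvcq.mul higq)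
  obtain ⟨hp₁, hp₂⟩ := isUniformlyBounded_filter (x₁ := fun s => p₁ s.1) (x₂ := fun s => p₂ s.1)
    hD.ξp hD.ωpc (by fun_prop) (by fun_prop) (hP.of_abs_le fun x => abs_sat_le_abs hD.Pbar _)
    fun s t vgd vgq h => ⟨hasDerivAt_p₁ h, hasDerivAt_p₂ h⟩
  have hfreq : IsUniformlyBounded Ω D fun s => freq D s.1 :=
    (IsUniformlyBounded.const D.ω₀).add ((IsUniformlyBounded.const D.KP).mul
      ((IsUniformlyBounded.const D.P₀).sub hp₁))
  have hidr : IsUniformlyBounded Ω D fun s => itdRef Ω D s.1 :=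
    ((higd.sub (((IsUniformlyBounded.const Ω.Cf).mul hfreq).mul hvcq)).sub
      ((IsUniformlyBounded.const (Ω.Cf * D.KQ / Ω.ωb)).mul hq₂)).sub
      ((IsUniformlyBounded.const (Ω.Cf * D.KVC / Ω.ωb)).mul evd)
  have hiqr : IsUniformlyBounded Ω D fun s => itqRef Ω D s.1 :=
    (higq.add (((IsUniformlyBounded.const Ω.Cf).mul hfreq).mul hvcd)).sub
      ((IsUniformlyBounded.const (Ω.Cf * D.KVC / Ω.ωb)).mul hvcq)
  have hitd : IsUniformlyBounded Ω D fun s => itd s.1 := (eid.add hidr).congr fun x => by ring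
  have hitq : IsUniformlyBounded Ω D fun s => itq s.1 := (eiq.add hiqr).congr fun x => by ring
  fin_cases i
  exacts [hvcd, hvcq, hitd, hitq, higd, higq, hq₁, hq₂, hp₁, hp₂]

theorem exists_norm_le (hD : D.Admissible) (hΩ : Ω.Pos) (M : ℝ) :
    ∃ C, ∀ T s, IsBoundedDataSolution Ω D M T s → ‖s T‖ ≤ C := by
  choose C hC using fun i => isUniformlyBounded_coord hD hΩ i M
  obtain ⟨Cd, hCd⟩ := (isUniformlyBounded_d hD hΩ).2 M
  obtain ⟨Cq, hCq⟩ := (isUniformlyBounded_q hD hΩ).2 M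
  refine ⟨max (Real.sqrt (∑ i, C i ^ 2)) (max Cd Cq), fun T s hs => ?_⟩
  rw [Prod.norm_def, Prod.norm_def]
  refine max_le_max ?_ (max_le_max (hCd T s hs) (hCq T s hs))
  rw [EuclideanSpace.norm_eq]
  exact Real.sqrt_le_sqrt (Finset.sum_le_sum fun i _ =>
    pow_le_pow_left₀ (norm_nonneg _) (hC i T s hs) 2)

/-! ### Limits of the gains and the continuous bound -/

theorem exists_tendsto_of_monotoneOn_Ici {z : ℝ → ℝ} {b : ℝ} (hz : MonotoneOn z (Ici 0))
    (hb : ∀ t, 0 ≤ t → z t ≤ b) :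
    ∃ l, Tendsto z atTop (𝓝 l) ∧ (∀ t, 0 ≤ t → z t ≤ l) ∧ l ≤ b := by
  have hmono : Monotone fun t => z (max t 0) := fun a c hac =>
    hz (mem_Ici.2 (le_max_right _ _)) (mem_Ici.2 (le_max_right _ _)) (max_le_max hac le_rfl)
  have hbdd : BddAbove (range fun t => z (max t 0)) :=
    ⟨b, by rintro _ ⟨t, rfl⟩; exact hb _ (le_max_right _ _)⟩
  refine ⟨⨆ t, z (max t 0), (tendsto_atTop_ciSup hmono hbdd).congr' ?_, fun t ht => ?_,
    ciSup_le fun t => hb _ (le_max_right _ _)⟩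
  · filter_upwards [eventually_ge_atTop 0] with t ht
    rw [max_eq_left ht]
  · simpa only [max_eq_left ht] using le_ciSup hbdd t

/-- `c` bounds the solutions, at all times, for the given initial state and norms of the
grid voltages. -/
def IsSolutionBound (Ω : PhysParams) (D : DesignParams) (d : X × ℝ × ℝ × ℝ≥0 × ℝ≥0) (c : ℝ) :
    Prop :=
  ∀ vgd vgq : ℝ → ℝ, MemLp vgd ⊤ halfLine → MemLp vgq ⊤ halfLine →
    supNorm vgd = d.2.2.2.1 → supNorm vgq = d.2.2.2.2 → ∀ T, 0 ≤ T → ∀ s,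
    IsSolutionOn Ω D vgd vgq (d.1, d.2.1, d.2.2.1) (Icc 0 T) s → ‖s T‖ ≤ c

/-- Near each datum one constant works, and the admissible constants form an upper set, hence a
convex one; a partition of unity therefore yields a continuous selection. -/
theorem exists_continuous_isSolutionBound (hD : D.Admissible) (hΩ : Ω.Pos) :
    ∃ B : X × ℝ × ℝ × ℝ≥0 × ℝ≥0 → ℝ≥0, Continuous B ∧ ∀ d, IsSolutionBound Ω D d (B d) := by
  obtain ⟨g, hg⟩ := exists_continuous_forall_mem_convex_of_local_const
    (t := fun d : X × ℝ × ℝ × ℝ≥0 × ℝ≥0 => {c : ℝ | IsSolutionBound Ω D d c}) (fun d => by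
      have : IsUpperSet {c : ℝ | IsSolutionBound Ω D d c} :=
        fun c c' hcc' hc vgd vgq h1 h2 h3 h4 T hT s hs =>
          (hc vgd vgq h1 h2 h3 h4 T hT s hs).trans hcc'
      exact this.ordConnected.convex) (fun d => by
      let m : X × ℝ × ℝ × ℝ≥0 × ℝ≥0 → ℝ := fun y =>
        ‖((y.1, y.2.1, y.2.2.1) : State)‖ + y.2.2.2.1 + y.2.2.2.2
      have hm : Continuous m := by fun_prop
      obtain ⟨C, hC⟩ := exists_norm_le hD hΩ (m d + 1)
      refine ⟨C, ?_⟩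
      filter_upwards [hm.continuousAt.eventually_lt_const (lt_add_one (m d))] with y hy
      intro vgd vgq hd hq h1 h2 T hT s hs
      simp only [m] at hy
      have hn := norm_nonneg ((y.1, y.2.1, y.2.2.1) : State)
      have h0 := NNReal.coe_nonneg y.2.2.2.1
      have h0' := NNReal.coe_nonneg y.2.2.2.2
      refine hC T s ⟨hT, ?_, hs.absCont 0 (left_mem_Icc.2 hT) T (right_mem_Icc.2 hT), ?_⟩
      · rw [hs.init]
        linarith
      · filter_upwards [hs.ode,
          ae_restrict_of_ae_restrict_of_subset Icc_subset_Ici_self (ae_abs_le_supNorm hd),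
          ae_restrict_of_ae_restrict_of_subset Icc_subset_Ici_self (ae_abs_le_supNorm hq)]
          with t e1 e2 e3
        rw [h1] at e2
        rw [h2] at e3
        exact ⟨vgd t, vgq t, by linarith, by linarith, e1⟩)
  refine ⟨fun d => (g d).toNNReal, continuous_real_toNNReal.comp g.continuous,
    fun d vgd vgq h1 h2 h3 h4 T hT s hs => ?_⟩
  exact (hg d vgd vgq h1 h2 h3 h4 T hT s hs).trans (Real.le_coe_toNNReal _)

end GFM

/-! ### The main theorem -/

theorem theorem1 (D : GFM.DesignParams) (hD : D.Admissible)
    (Ω : GFM.PhysParams) (hΩ : Ω.Pos) :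
    ∃ B : GFM.X × ℝ × ℝ × ℝ≥0 × ℝ≥0 → ℝ≥0, Continuous B ∧
      ∀ vgd vgq : ℝ → ℝ, MemLp vgd ⊤ GFM.halfLine → MemLp vgq ⊤ GFM.halfLine →
      ∀ (x₀ : GFM.X) (zd₀ zq₀ : ℝ),
      ∃ (x : ℝ → GFM.X) (zd zq : ℝ → ℝ),
        GFM.IsSolutionOn Ω D vgd vgq (x₀, zd₀, zq₀) (Ici 0) (fun t => (x t, zd t, zq t)) ∧
        (∀ s : ℝ → GFM.State, GFM.IsSolutionOn Ω D vgd vgq (x₀, zd₀, zq₀) (Ici 0) s →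
          ∀ t, 0 ≤ t → s t = (x t, zd t, zq t)) ∧
        (∀ T : ℝ, 0 < T → ∀ s : ℝ → GFM.State,
          GFM.IsSolutionOn Ω D vgd vgq (x₀, zd₀, zq₀) (Ico 0 T) s →
          ∀ t ∈ Ico 0 T, s t = (x t, zd t, zq t)) ∧
        (∀ t, 0 ≤ t → ‖x t‖ ≤ B (x₀, zd₀, zq₀, GFM.supNorm vgd, GFM.supNorm vgq)) ∧
        MonotoneOn zd (Ici 0) ∧ MonotoneOn zq (Ici 0) ∧
        ∃ zdInf zqInf : ℝ,
          Tendsto zd atTop (𝓝 zdInf) ∧ Tendsto zq atTop (𝓝 zqInf) ∧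
          (∀ t, 0 ≤ t → zd₀ ≤ zd t ∧ zd t ≤ zdInf) ∧
          (∀ t, 0 ≤ t → zq₀ ≤ zq t ∧ zq t ≤ zqInf) ∧
          zdInf ≤ B (x₀, zd₀, zq₀, GFM.supNorm vgd, GFM.supNorm vgq) ∧
          zqInf ≤ B (x₀, zd₀, zq₀, GFM.supNorm vgd, GFM.supNorm vgq) := by
  obtain ⟨B, hB, hbound⟩ := GFM.exists_continuous_isSolutionBound hD hΩ
  refine ⟨B, hB, fun vgd vgq hd hq x₀ zd₀ zq₀ => ?_⟩
  have hF := GFM.locallyLipschitz_closedLoop Ω D hD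
  obtain ⟨U, hU⟩ := GFM.exists_primitive_gridInput Ω hd hq
  have hb := hbound (x₀, zd₀, zq₀, GFM.supNorm vgd, GFM.supNorm vgq) vgd vgq hd hq rfl rfl
  simp only at hb
  generalize B (x₀, zd₀, zq₀, GFM.supNorm vgd, GFM.supNorm vgq) = c at hb ⊢
  obtain ⟨s, hs0, hs⟩ := exists_isCaratheodorySolutionOn_Ici (s₀ := (x₀, zd₀, zq₀)) hF hU
    (fun T hT s h0 h => hb T hT s (GFM.isSolutionOn_iff.2 ⟨h0, h⟩))
  have hsol : GFM.IsSolutionOn Ω D vgd vgq (x₀, zd₀, zq₀) (Ici 0) s :=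
    GFM.isSolutionOn_iff.2 ⟨hs0, hs⟩
  have hnorm : ∀ t, 0 ≤ t → ‖s t‖ ≤ c := fun t ht =>
    hb t ht s (GFM.isSolutionOn_iff.2 ⟨hs0, hs.mono Icc_subset_Ici_self⟩)
  -- Comparison at the right end of each `[0, t]` serves solutions on the half-line and on `[0, T)`
  -- alike.
  have hunique : ∀ s' t, 0 ≤ t → GFM.IsSolutionOn Ω D vgd vgq (x₀, zd₀, zq₀) (Icc 0 t) s' →
      s' t = s t := fun s' t ht h' => by
    obtain ⟨h0', h'⟩ := GFM.isSolutionOn_iff.1 h'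
    exact h'.eqOn_Icc hF ht (hs.mono Icc_subset_Ici_self) (h0'.trans hs0.symm) (right_mem_Icc.2 ht)
  have hrestrict : ∀ {I : Set ℝ} {s' : ℝ → GFM.State} {t : ℝ}, Icc 0 t ⊆ I →
      GFM.IsSolutionOn Ω D vgd vgq (x₀, zd₀, zq₀) I s' →
      GFM.IsSolutionOn Ω D vgd vgq (x₀, zd₀, zq₀) (Icc 0 t) s' := fun hI h' =>
    GFM.isSolutionOn_iff.2 ((GFM.isSolutionOn_iff.1 h').imp_right fun h => h.mono hI)
  have hmd : MonotoneOn (fun t => (s t).2.1) (Ici 0) :=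
    monotoneOn_of_ae_deriv_nonneg ordConnected_Ici
      (fun a ha b hb => (by fun_prop : ContDiff ℝ 1 fun y : GFM.State =>
        y.2.1).comp_absolutelyContinuousOnInterval (hs.absCont a ha b hb)) (by
        have := hD.Γd
        filter_upwards [hsol.ode] with t ht
        exact ⟨_, GFM.hasDerivAt_zd ht, by positivity⟩)
  have hmq : MonotoneOn (fun t => (s t).2.2) (Ici 0) :=
    monotoneOn_of_ae_deriv_nonneg ordConnected_Ici
      (fun a ha b hb => (by fun_prop : ContDiff ℝ 1 fun y : GFM.State =>
        y.2.2).comp_absolutelyContinuousOnInterval (hs.absCont a ha b hb)) (by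
        have := hD.Γq
        filter_upwards [hsol.ode] with t ht
        exact ⟨_, GFM.hasDerivAt_zq ht, by positivity⟩)
  -- The norm of `State` is the maximum over its components, so the single bound `c` covers `x` and
  -- both gains.
  obtain ⟨ld, hld, hdle, hldc⟩ := GFM.exists_tendsto_of_monotoneOn_Ici hmd (b := c) fun t ht =>
    (le_abs_self _).trans ((norm_fst_le (s t).2).trans ((norm_snd_le (s t)).trans (hnorm t ht)))
  obtain ⟨lq, hlq, hqle, hlqc⟩ := GFM.exists_tendsto_of_monotoneOn_Ici hmq (b := c) fun t ht =>
    (le_abs_self _).trans ((norm_snd_le (s t).2).trans ((norm_snd_le (s t)).trans (hnorm t ht)))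
  refine ⟨fun t => (s t).1, fun t => (s t).2.1, fun t => (s t).2.2, hsol,
    fun s' h' t ht => hunique s' t ht (hrestrict Icc_subset_Ici_self h'),
    fun T _ s' h' t ht => hunique s' t ht.1 (hrestrict (Icc_subset_Ico_right ht.2) h'),
    fun t ht => (norm_fst_le (s t)).trans (hnorm t ht), hmd, hmq, ld, lq, hld, hlq,
    fun t ht => ⟨?_, hdle t ht⟩, fun t ht => ⟨?_, hqle t ht⟩, hldc, hlqc⟩
  · simpa [hs0] using hmd self_mem_Ici ht ht
  · simpa [hs0] using hmq self_mem_Ici ht ht
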